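/- Let $X_1,X_2,\dots$ and $Y_1,Y_2,\dots$ be independent random variables (all of them jointly independent) with $X_i\sim N(\mu_1,\sigma^2)$ and $Y_j\sim N(\mu_2,\sigma^2)$, where $\mu_1,\mu_2\in\mathbb R$ and $\sigma>0$ are fixed, and let $n_1\ge 1$ be a fixed integer (the initial sample size). For $n\ge 1$ put $\bar Z_n=\frac1{2n}\sum_{i=1}^n(X_i+Y_i)$ and let $$\hat\sigma^2_{n,blind}=\frac1{2n-1}\Big(\sum_{i=1}^n(X_i-\bar Z_n)^2+\sum_{j=1}^n(Y_j-\bar Z_n)^2\Big)$$ be the blinded variance estimator. For real $v>0$ let $N_b=N_b(v)=\min\{n\ge n_1 : \hat\sigma^2_{n,blind}\le n/v\}$ (with $\min\emptyset=\infty$), $n_{req}=v\sigma^2$, and $c=1+\frac{(\mu_1-\mu_2)^2}{4\sigma^2}$. Then: (i) $N_b$ is well defined: almost surely $N_b(v)<\infty$ for all $v>0$, and $E(N_b)<\infty$, $E(N_b^2)<\infty$ for every $v>0$. It is non-decreasing as a function of $v>0$. Moreover, as $v\to\infty$, $N_b(v)\to\infty$ almost surely and $E(N_b)\to\infty$. (ii)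 $\lim_{v\to\infty}N_b/n_{req}=c$ almost surely. (iii) $\lim_{v\to\infty}E(N_b/n_{req})=c$. (iv) $\lim_{v\to\infty}E(N_b^2/n_{req}^2)=c^2$. (v) As $v\to\infty$, $$\frac{N_b-c\,n_{req}}{\sqrt{n_{req}}}\ \xrightarrow{d}\ N\!\left(0,\ \frac{4\sigma^2+2(\mu_1-\mu_2)^2}{4\sigma^2+(\mu_1-\mu_2)^2}\right).$$ -/

import Mathlib

open MeasureTheory ProbabilityTheory Filter Topology

/-- The mean of the pooled sample `x 0, …, x (n - 1), y 0, …, y (n - 1)` (group labels are not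
used). -/
noncomputable def blindMean (x y : ℕ → ℝ) (n : ℕ) : ℝ :=
  (∑ i ∈ Finset.range n, (x i + y i)) / (2 * (n : ℝ))

/-- The blinded variance estimator: the one-sample variance of the pooled sample of size `2 n`,
with denominator `2 n - 1`. -/
noncomputable def blindVar (x y : ℕ → ℝ) (n : ℕ) : ℝ :=
  (1 / (2 * (n : ℝ) - 1)) *
    (∑ i ∈ Finset.range n, (x i - blindMean x y n) ^ 2 +
      ∑ j ∈ Finset.range n, (y j - blindMean x y n) ^ 2)

/-- The sample size per group in blinded continuous monitoring: the least `n ≥ n₁` at which the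
blinded variance estimator is at most `n / v`, and `⊤` when there is no such `n`. -/
noncomputable def blindSampleSize (n₁ : ℕ) (v : ℝ) (x y : ℕ → ℝ) : ℕ∞ :=
  sInf ((fun n : ℕ => (n : ℕ∞)) '' {n : ℕ | n₁ ≤ n ∧ blindVar x y n ≤ (n : ℝ) / v})

/-- The sample size of blinded continuous monitoring as a random variable, for the data
sequences `X` and `Y` of the two groups. -/
noncomputable def stopN {Ω : Type*} (X Y : ℕ → Ω → ℝ) (n₁ : ℕ) (v : ℝ) (ω : Ω) : ℕ∞ :=
  blindSampleSize n₁ v (fun i => X i ω) (fun i => Y i ω)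

/-- The real-valued version of `stopN`; it agrees with it wherever `stopN` is finite. -/
noncomputable def stopNReal {Ω : Type*} (X Y : ℕ → Ω → ℝ) (n₁ : ℕ) (v : ℝ) (ω : Ω) : ℝ :=
  ((stopN X Y n₁ v ω).toNat : ℝ)

/-- The optimal fixed sample size per group when the variance `σ ^ 2` is known. -/
def nReq (v σ : ℝ) : ℝ := v * σ ^ 2

/-! ### The blinded variance and the sample size for deterministic data -/

/-! Centre at the midpoint m = (μ₁ + μ₂)/2 and put W_i = (X_i - m)² + (Y_i - m)², D_i = X_i + Y_i -
2m. Then (2n - 1) times the blinded variance is ΣW_i - (ΣD_i)²/(2n), a function of two sums of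
i.i.d. terms with E W = 2θ and E D = 0, where θ = σ² + (μ₁ - μ₂)²/4 = cσ². The strong law makes the
blinded variance converge to θ. The stopping rule holds at N and fails at N - 1, so N/v is squeezed
to θ (`tendsto_blindSampleSize_div`).

For the moments, N ≤ n₁ + 1 + Mv with M a square-integrable bound on all running means of W
(`exists_memLp_two_sum_le`, `blindSampleSize_le`); dominated convergence does the rest.

For the limit law, the two stopping inequalities trap 2(N/v)(N - θv) between centred sums of W up to
N and N - 1, with errors of order o(√v) (`stopping_squeeze`). Anscombe's theorem, via Kolmogorov's
inequality, replaces the random index by ⌊θv⌋. The central limit theorem applies there, and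
Slutsky's lemma divides by 2N/v → 2θ. The limiting variance is Var W/(4θσ²). -/

theorem blindVar_eq_centered (x y : ℕ → ℝ) (m : ℝ) {n : ℕ} (hn : 1 ≤ n) :
    blindVar x y n = (∑ i ∈ Finset.range n, ((x i - m) ^ 2 + (y i - m) ^ 2) -
      (∑ i ∈ Finset.range n, (x i + y i - 2 * m)) ^ 2 / (2 * (n : ℝ))) / (2 * (n : ℝ) - 1) := by
  have hn0 : (n : ℝ) ≠ 0 := by positivity
  rw [blindVar, one_div, div_eq_inv_mul]
  congr 1
  simp only [blindMean, sub_sq, Finset.sum_add_distrib, Finset.sum_sub_distrib, Finset.sum_const,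
    Finset.card_range, nsmul_eq_mul, ← Finset.mul_sum, ← Finset.sum_mul]
  field_simp
  ring

theorem two_mul_sub_one_pos {n : ℕ} (hn : 1 ≤ n) : 0 < 2 * (n : ℝ) - 1 := by
  have : (1 : ℝ) ≤ n := by exact_mod_cast hn
  linarith

/-- No centre b is close to two distinct points: (x₀ - b)² + (y₀ - b)² ≥ (x₀ - y₀)²/2. One
inequality between the first observations thus serves every n. -/
theorem blindVar_pos {x y : ℕ → ℝ} (h : x 0 ≠ y 0) {n : ℕ} (hn : 1 ≤ n) :
    0 < blindVar x y n := by
  have h0 : (0 : ℕ) ∈ Finset.range n := Finset.mem_range.2 hn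
  have hx := Finset.single_le_sum (f := fun i => (x i - blindMean x y n) ^ 2)
    (fun i _ => sq_nonneg _) h0
  have hy := Finset.single_le_sum (f := fun i => (y i - blindMean x y n) ^ 2)
    (fun i _ => sq_nonneg _) h0
  have hpos : 0 < (x 0 - y 0) ^ 2 := by
    have := sub_ne_zero.2 h
    positivity
  refine mul_pos (one_div_pos.2 (two_mul_sub_one_pos hn)) ?_
  nlinarith [sq_nonneg (x 0 - blindMean x y n + (y 0 - blindMean x y n))]

theorem blindSampleSize_spec {n₁ : ℕ} {v : ℝ} {x y : ℕ → ℝ}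
    (h : ∃ n : ℕ, n₁ ≤ n ∧ blindVar x y n ≤ (n : ℝ) / v) :
    ∃ N : ℕ, blindSampleSize n₁ v x y = N ∧ n₁ ≤ N ∧ blindVar x y N ≤ (N : ℝ) / v ∧
      ∀ n : ℕ, n₁ ≤ n → n < N → (n : ℝ) / v < blindVar x y n := by
  classical
  refine ⟨Nat.find h, ?_, (Nat.find_spec h).1, (Nat.find_spec h).2, fun n hn hlt => ?_⟩
  · refine IsLeast.csInf_eq ⟨⟨_, Nat.find_spec h, rfl⟩, ?_⟩
    rintro _ ⟨n, hn, rfl⟩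
    exact Nat.cast_le.2 (Nat.find_min' h hn)
  · have := Nat.find_min h hlt
    push Not at this
    exact this hn

/-- The conventions agree on the empty set: `⊤.toNat` and the infimum of `∅` in `ℕ` are both 0. -/
theorem toNat_sInf_image_natCast (s : Set ℕ) :
    (sInf ((fun n : ℕ => (n : ℕ∞)) '' s)).toNat = sInf s := by
  rcases s.eq_empty_or_nonempty with rfl | hs
  · simp
  · have : IsLeast ((fun n : ℕ => (n : ℕ∞)) '' s) ((sInf s : ℕ) : ℕ∞) := by
      refine ⟨⟨_, Nat.sInf_mem hs, rfl⟩, ?_⟩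
      rintro _ ⟨n, hn, rfl⟩
      exact Nat.cast_le.2 (Nat.sInf_le hn)
    rw [this.csInf_eq, ENat.toNat_natCast]

theorem blindSampleSize_mono {n₁ : ℕ} {x y : ℕ → ℝ} {v w : ℝ} (hv : 0 < v)
    (hvw : v ≤ w) : blindSampleSize n₁ v x y ≤ blindSampleSize n₁ w x y := by
  refine sInf_le_sInf (Set.image_mono ?_)
  rintro n ⟨hn, h⟩
  exact ⟨hn, h.trans (by gcongr)⟩

/-- If the centred sums of squares grow at most linearly, so does the sample size in `v`. -/
theorem blindSampleSize_le {n₁ : ℕ} (hn₁ : 1 ≤ n₁) {x y : ℕ → ℝ} {m B v : ℝ} (hB : 0 ≤ B)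
    (hv : 0 < v)
    (h : ∀ n : ℕ, 1 ≤ n → ∑ i ∈ Finset.range n, ((x i - m) ^ 2 + (y i - m) ^ 2) ≤ B * n) :
    blindSampleSize n₁ v x y < ⊤ ∧
      ((blindSampleSize n₁ v x y).toNat : ℝ) ≤ n₁ + 1 + B * v := by
  -- At this k the threshold k/v is at least B, while the blinded variance is at most Bk/(2k - 1) ≤
  -- B.
  set k := max n₁ ⌈B * v⌉₊ with hk
  have hk1 : 1 ≤ k := hn₁.trans (le_max_left _ _)
  have hkR : (1 : ℝ) ≤ k := by exact_mod_cast hk1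
  have hle : blindVar x y k ≤ (k : ℝ) / v := by
    have h1 : blindVar x y k ≤ B := by
      rw [blindVar_eq_centered x y m hk1, div_le_iff₀ (two_mul_sub_one_pos hk1)]
      have h2 : 0 ≤ (∑ i ∈ Finset.range k, (x i + y i - 2 * m)) ^ 2 / (2 * (k : ℝ)) := by
        positivity
      nlinarith [h k hk1]
    refine h1.trans ?_
    rw [le_div_iff₀ hv]
    refine (Nat.le_ceil _).trans ?_
    exact_mod_cast le_max_right _ _
  have hmem : (blindSampleSize n₁ v x y) ≤ (k : ℕ∞) :=
    sInf_le ⟨k, ⟨le_max_left _ _, hle⟩, rfl⟩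
  refine ⟨hmem.trans_lt (ENat.natCast_lt_top k), ?_⟩
  have h3 : (blindSampleSize n₁ v x y).toNat ≤ k := ENat.toNat_le_of_le_natCast hmem
  have h4 : (k : ℝ) ≤ n₁ + 1 + B * v := by
    have h5 := (Nat.ceil_lt_add_one (mul_nonneg hB hv.le)).le
    have hn0 : (0 : ℝ) ≤ n₁ := Nat.cast_nonneg _
    have hBv := mul_nonneg hB hv.le
    rw [hk, Nat.cast_max]
    exact max_le (by linarith) (by linarith)
  exact (Nat.cast_le.2 h3).trans h4

/-- Each fixed n is eventually rejected, because n/v → 0 and the variance at n is positive.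
Finiteness must be checked too, since an infinite sample size would be read as 0. -/
theorem tendsto_blindSampleSize_toNat_atTop {n₁ : ℕ} (hn₁ : 1 ≤ n₁) {x y : ℕ → ℝ} {θ : ℝ}
    (hpos : ∀ n, 1 ≤ n → 0 < blindVar x y n)
    (hlim : Tendsto (blindVar x y) atTop (𝓝 θ)) :
    Tendsto (fun v : ℝ => (blindSampleSize n₁ v x y).toNat) atTop atTop := by
  refine tendsto_atTop.2 fun K => ?_
  have hev : ∀ᶠ v : ℝ in atTop, ∀ n ∈ Finset.Icc n₁ K, (n : ℝ) / v < blindVar x y n := by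
    rw [Filter.eventually_all_finset]
    intro n hn
    have : Tendsto (fun v : ℝ => (n : ℝ) / v) atTop (𝓝 0) := tendsto_const_nhds.div_atTop tendsto_id
    exact this.eventually_lt_const (hpos n (hn₁.trans (Finset.mem_Icc.1 hn).1))
  filter_upwards [hev, eventually_gt_atTop 0] with v hv hv0
  have hex : ∃ n : ℕ, n₁ ≤ n ∧ blindVar x y n ≤ (n : ℝ) / v := by
    have h1 : Tendsto (fun n : ℕ => (n : ℝ) / v) atTop atTop :=
      tendsto_natCast_atTop_atTop.atTop_div_const hv0
    have h2 := hlim.eventually_le_const (lt_add_one θ)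
    obtain ⟨n, hn⟩ := ((h1.eventually_ge_atTop (θ + 1)).and (h2.and (eventually_ge_atTop n₁))).exists
    exact ⟨n, hn.2.2, hn.2.1.trans hn.1⟩
  obtain ⟨N, hN, hN1, hN2, -⟩ := blindSampleSize_spec hex
  rw [hN, ENat.toNat_natCast]
  by_contra hlt
  exact absurd hN2 (not_le.2 (hv N (Finset.mem_Icc.2 ⟨hN1, (not_le.1 hlt).le⟩)))

/-- The sample size is squeezed between the blinded variances at its value and one step before. -/
theorem eventually_blindVar_le_and_lt {n₁ : ℕ} (hn₁ : 1 ≤ n₁) {x y : ℕ → ℝ} {θ : ℝ}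
    (hpos : ∀ n, 1 ≤ n → 0 < blindVar x y n)
    (hlim : Tendsto (blindVar x y) atTop (𝓝 θ)) :
    ∀ᶠ v : ℝ in atTop, 2 ≤ (blindSampleSize n₁ v x y).toNat ∧
      blindVar x y (blindSampleSize n₁ v x y).toNat
        ≤ ((blindSampleSize n₁ v x y).toNat : ℝ) / v ∧
      (((blindSampleSize n₁ v x y).toNat : ℝ) - 1) / v
        < blindVar x y ((blindSampleSize n₁ v x y).toNat - 1) := by
  have h := tendsto_blindSampleSize_toNat_atTop hn₁ hpos hlim
  -- Exceeding n₁ + 1 excludes the default value 0 and leaves N - 1 ≥ n₁, so that minimality applies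
  -- at N - 1.
  filter_upwards [h.eventually_gt_atTop (n₁ + 1)] with v hv
  have hex : ∃ n : ℕ, n₁ ≤ n ∧ blindVar x y n ≤ (n : ℝ) / v := by
    by_contra hcon
    have : {n : ℕ | n₁ ≤ n ∧ blindVar x y n ≤ (n : ℝ) / v} = ∅ := by
      ext n
      simpa using fun h1 => not_le.1 fun h2 => hcon ⟨n, h1, h2⟩
    rw [blindSampleSize, toNat_sInf_image_natCast, this] at hv
    simp at hv
  obtain ⟨N, hN, hN1, hN2, hN3⟩ := blindSampleSize_spec hex
  rw [hN, ENat.toNat_natCast] at hv ⊢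
  refine ⟨by omega, hN2, ?_⟩
  have := hN3 (N - 1) (by omega) (by omega)
  rwa [Nat.cast_sub (by omega), Nat.cast_one] at this

theorem tendsto_blindSampleSize_div {n₁ : ℕ} (hn₁ : 1 ≤ n₁) {x y : ℕ → ℝ} {θ : ℝ}
    (hpos : ∀ n, 1 ≤ n → 0 < blindVar x y n)
    (hlim : Tendsto (blindVar x y) atTop (𝓝 θ)) :
    Tendsto (fun v : ℝ => ((blindSampleSize n₁ v x y).toNat : ℝ) / v) atTop (𝓝 θ) := by
  have h := tendsto_blindSampleSize_toNat_atTop hn₁ hpos hlim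
  have hinv : Tendsto (fun v : ℝ => 1 / v) atTop (𝓝 0) := tendsto_const_nhds.div_atTop tendsto_id
  have hup := ((hlim.comp ((tendsto_sub_atTop_nat 1).comp h))).add hinv
  rw [add_zero] at hup
  refine tendsto_of_tendsto_of_tendsto_of_le_of_le' (hlim.comp h) hup ?_ ?_
  · filter_upwards [eventually_blindVar_le_and_lt hn₁ hpos hlim] with v hv using hv.2.1
  · filter_upwards [eventually_blindVar_le_and_lt hn₁ hpos hlim] with v hv
    have := hv.2.2.le
    rw [sub_div] at this
    simp only [Function.comp]
    linarith

/-! ### Measurability of the sample size -/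

theorem measurable_nat_sInf {α : Type*} [MeasurableSpace α] {p : ℕ → α → Prop}
    (hp : ∀ n, MeasurableSet {a | p n a}) : Measurable fun a => sInf {n | p n a} := by
  classical
  refine measurable_to_countable' fun k => ?_
  -- Either k is the first success, or there is no success and k is the default 0.
  have hset : (fun a => sInf {n | p n a}) ⁻¹' {k} =
      ({a | p k a} ∩ ⋂ j ∈ Finset.range k, {a | p j a}ᶜ) ∪
        ({_a | k = 0} ∩ ⋂ j, {a | p j a}ᶜ) := by
    ext a
    simp only [Set.mem_preimage, Set.mem_singleton_iff, Set.mem_union, Set.mem_inter_iff,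
      Set.mem_ofPred_eq, Set.mem_iInter, Finset.mem_range, Set.mem_compl_iff]
    constructor
    · rintro rfl
      rcases Set.eq_empty_or_nonempty {n | p n a} with he | hne
      · right
        exact ⟨by rw [he, Nat.sInf_empty], fun j hj => (Set.mem_empty_iff_false j).1 (he ▸ hj)⟩
      · exact Or.inl ⟨Nat.sInf_mem hne, fun j hj => Nat.notMem_of_lt_sInf hj⟩
    · rintro (⟨hk, hj⟩ | ⟨rfl, hj⟩)
      · refine le_antisymm (Nat.sInf_le hk) (not_lt.1 fun hlt => hj _ hlt ?_)
        exact Nat.sInf_mem (s := {n | p n a}) ⟨k, hk⟩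
      · rw [show {n | p n a} = ∅ from Set.eq_empty_of_forall_notMem hj, Nat.sInf_empty]
  rw [hset]
  refine ((hp k).inter (Finset.measurableSet_biInter _ fun j _ => (hp j).compl)).union
    ((MeasurableSet.const _).inter (MeasurableSet.iInter fun j => (hp j).compl))

theorem measurable_blindVar (n : ℕ) :
    Measurable fun z : (ℕ → ℝ) × (ℕ → ℝ) => blindVar z.1 z.2 n := by
  unfold blindVar blindMean
  fun_prop

theorem aemeasurable_stopN_toNat {Ω : Type*} [MeasurableSpace Ω] {P : Measure Ω}
    {X Y : ℕ → Ω → ℝ} (hX : ∀ i, AEMeasurable (X i) P) (hY : ∀ i, AEMeasurable (Y i) P)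
    (n₁ : ℕ) (v : ℝ) : AEMeasurable (fun ω => (stopN X Y n₁ v ω).toNat) P := by
  have h1 : Measurable fun z : (ℕ → ℝ) × (ℕ → ℝ) => (blindSampleSize n₁ v z.1 z.2).toNat := by
    simp only [blindSampleSize, toNat_sInf_image_natCast]
    refine measurable_nat_sInf fun n => (MeasurableSet.const _).inter ?_
    exact measurableSet_le (measurable_blindVar n) measurable_const
  have h2 : AEMeasurable (fun ω => ((fun i => X i ω), fun i => Y i ω)) P :=
    (aemeasurable_pi_iff.2 hX).prodMk (aemeasurable_pi_iff.2 hY)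
  change AEMeasurable ((fun z : (ℕ → ℝ) × (ℕ → ℝ) => (blindSampleSize n₁ v z.1 z.2).toNat) ∘
    fun ω => ((fun i => X i ω), fun i => Y i ω)) P
  exact h1.comp_aemeasurable h2

theorem aemeasurable_stopNReal {Ω : Type*} [MeasurableSpace Ω] {P : Measure Ω}
    {X Y : ℕ → Ω → ℝ} (hX : ∀ i, AEMeasurable (X i) P) (hY : ∀ i, AEMeasurable (Y i) P)
    (n₁ : ℕ) (v : ℝ) : AEMeasurable (stopNReal X Y n₁ v) P :=
  (measurable_from_top (f := fun n : ℕ => (n : ℝ))).comp_aemeasurable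
    (aemeasurable_stopN_toNat hX hY n₁ v)

/-! ### Sums of independent square-integrable variables -/

section Sums

variable {Ω : Type*} [MeasurableSpace Ω] {P : Measure Ω}

theorem variance_sum_range_of_iIndepFun {ξ : ℕ → Ω → ℝ} (hind : iIndepFun ξ P)
    (hL2 : ∀ i, MemLp (ξ i) 2 P) (n : ℕ) :
    Var[fun ω => ∑ i ∈ Finset.range n, ξ i ω; P] = ∑ i ∈ Finset.range n, Var[ξ i; P] := by
  have h := IndepFun.variance_sum (X := ξ) (s := Finset.range n) (fun i _ => hL2 i)
    (fun i _ j _ hij => hind.indepFun hij)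
  rw [← h]
  congr 1
  ext ω
  simp

theorem integral_sq_sum_range {ξ : ℕ → Ω → ℝ} [IsProbabilityMeasure P] (hind : iIndepFun ξ P)
    (hL2 : ∀ i, MemLp (ξ i) 2 P) (hmean : ∀ i, P[ξ i] = 0) (n : ℕ) :
    ∫ ω, (∑ i ∈ Finset.range n, ξ i ω) ^ 2 ∂P = ∑ i ∈ Finset.range n, Var[ξ i; P] := by
  rw [← variance_sum_range_of_iIndepFun hind hL2, variance_of_integral_eq_zero]
  · exact (memLp_finsetSum _ fun i _ => hL2 i).aemeasurable
  · rw [integral_finsetSum _ fun i _ => (hL2 i).integrable one_le_two]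
    exact Finset.sum_eq_zero fun i _ => hmean i

/-- Expanding the square leaves a cross term, which integrates to zero over any event s of the past:
the indicator of s times the partial sum is independent of the next, centred variable. -/
theorem submartingale_sq_sum {ξ : ℕ → Ω → ℝ} [IsProbabilityMeasure P]
    (hm : ∀ i, StronglyMeasurable (ξ i)) (hind : iIndepFun ξ P)
    (hL2 : ∀ i, MemLp (ξ i) 2 P) (hmean : ∀ i, P[ξ i] = 0) :
    Submartingale (fun n ω => (∑ i ∈ Finset.range (n + 1), ξ i ω) ^ 2)
      (Filtration.natural ξ hm) P := by
  have hS2 : ∀ n, MemLp (fun ω => ∑ i ∈ Finset.range n, ξ i ω) 2 P := fun n =>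
    memLp_finsetSum _ fun i _ => hL2 i
  have hadp : ∀ n, StronglyMeasurable[Filtration.natural ξ hm n]
      (fun ω => ∑ i ∈ Finset.range (n + 1), ξ i ω) := by
    intro n
    refine Finset.stronglyMeasurable_fun_sum _ fun i hi => ?_
    exact (Filtration.stronglyAdapted_natural hm i).mono
      ((Filtration.natural ξ hm).mono (Nat.lt_succ_iff.1 (Finset.mem_range.1 hi)))
  refine submartingale_of_setIntegral_le_succ (fun n => (hadp n).pow 2)
    (fun n => (hS2 _).integrable_sq) fun n s hs => ?_
  have hs' : MeasurableSet s := (Filtration.natural ξ hm).le n s hs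
  set S : Ω → ℝ := fun ω => ∑ i ∈ Finset.range (n + 1), ξ i ω with hSdef
  have hexp : ∀ ω, (∑ i ∈ Finset.range (n + 1 + 1), ξ i ω) ^ 2 =
      S ω ^ 2 + (2 * (S ω * ξ (n + 1) ω) + ξ (n + 1) ω ^ 2) := by
    intro ω
    rw [Finset.sum_range_succ _ (n + 1)]
    simp only [hSdef]
    ring
  have hprod : Integrable (fun ω => S ω * ξ (n + 1) ω) P := (hS2 (n + 1)).integrable_mul (hL2 _)
  have hcross : ∫ ω in s, S ω * ξ (n + 1) ω ∂P = 0 := by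
    have h1 : ∫ ω in s, S ω * ξ (n + 1) ω ∂P = ∫ ω, s.indicator S ω * ξ (n + 1) ω ∂P := by
      rw [← integral_indicator hs']
      congr 1
      ext ω
      by_cases h : ω ∈ s <;> simp [h]
    have hmeas : Measurable[Filtration.natural ξ hm n] (s.indicator S) :=
      ((hadp n).indicator hs).measurable
    have hindep : IndepFun (s.indicator S) (ξ (n + 1)) P := by
      have := (hind.indep_comap_natural_of_lt hm (Nat.lt_succ_self n)).symm
      exact (IndepFun_iff_Indep _ _ _).2 (indep_of_indep_of_le_left this hmeas.comap_le)
    rw [h1, hindep.integral_fun_mul_eq_mul_integral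
      (hmeas.mono ((Filtration.natural ξ hm).le n) le_rfl).aestronglyMeasurable
      (hm _).aestronglyMeasurable, hmean, mul_zero]
  simp only [hexp]
  have hS2i : Integrable (fun ω => S ω ^ 2) P := (hS2 (n + 1)).integrable_sq
  have hrest : Integrable (fun ω => 2 * (S ω * ξ (n + 1) ω) + ξ (n + 1) ω ^ 2) P :=
    (hprod.const_mul 2).add (hL2 _).integrable_sq
  rw [integral_add hS2i.integrableOn hrest.integrableOn,
    integral_add (hprod.const_mul 2).integrableOn (hL2 _).integrable_sq.integrableOn,
    integral_const_mul, hcross, mul_zero, zero_add]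
  exact le_add_of_nonneg_right (integral_nonneg fun ω => sq_nonneg _)

/-- Doob's maximal inequality for the squared partial sums. That submartingale starts with one
summand, so the empty sum is treated separately. -/
theorem measure_exists_le_abs_sum_le_of_stronglyMeasurable {ξ : ℕ → Ω → ℝ}
    [IsProbabilityMeasure P]
    (hm : ∀ i, StronglyMeasurable (ξ i)) (hind : iIndepFun ξ P)
    (hL2 : ∀ i, MemLp (ξ i) 2 P) (hmean : ∀ i, P[ξ i] = 0) {ε : ℝ} (hε : 0 < ε) (L : ℕ) :
    P {ω | ∃ j ≤ L, ε ≤ |∑ i ∈ Finset.range j, ξ i ω|} ≤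
      ENNReal.ofReal ((∑ i ∈ Finset.range L, Var[ξ i; P]) / ε ^ 2) := by
  rcases L with _ | n
  · have : {ω | ∃ j ≤ 0, ε ≤ |∑ i ∈ Finset.range j, ξ i ω|} = ∅ := by
      ext ω
      simp [hε]
    rw [this, measure_empty]
    exact zero_le
  have hε2 : 0 < ε ^ 2 := by positivity
  have hmax := maximal_ineq (submartingale_sq_sum hm hind hL2 hmean)
    (fun n ω => sq_nonneg _) (ε := (ε ^ 2).toNNReal) n
  rw [Real.coe_toNNReal _ hε2.le] at hmax
  set A := {ω | ε ^ 2 ≤ (Finset.range (n + 1)).sup' Finset.nonempty_range_add_one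
    fun k => (∑ i ∈ Finset.range (k + 1), ξ i ω) ^ 2} with hA
  have hsub : {ω | ∃ j ≤ n + 1, ε ≤ |∑ i ∈ Finset.range j, ξ i ω|} ⊆ A := by
    rintro ω ⟨j, hj, hle⟩
    rcases j with _ | k
    · simp only [Finset.range_zero, Finset.sum_empty, abs_zero] at hle
      linarith
    · have hk : k ∈ Finset.range (n + 1) := Finset.mem_range.2 (by omega)
      refine Finset.le_sup'_of_le (fun k => (∑ i ∈ Finset.range (k + 1), ξ i ω) ^ 2) hk ?_
      rw [← sq_abs (∑ i ∈ Finset.range (k + 1), ξ i ω)]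
      gcongr
  have hint : Integrable (fun ω => (∑ i ∈ Finset.range (n + 1), ξ i ω) ^ 2) P :=
    (memLp_finsetSum _ fun i _ => hL2 i).integrable_sq
  have hle : ∫ ω in A, (∑ i ∈ Finset.range (n + 1), ξ i ω) ^ 2 ∂P ≤
      ∑ i ∈ Finset.range (n + 1), Var[ξ i; P] := by
    rw [← integral_sq_sum_range hind hL2 hmean]
    exact setIntegral_le_integral hint (Eventually.of_forall fun ω => sq_nonneg _)
  refine (measure_mono hsub).trans ?_
  rw [ENNReal.ofReal_div_of_pos hε2, ENNReal.le_div_iff_mul_le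
    (Or.inl (ENNReal.ofReal_pos.2 hε2).ne') (Or.inl ENNReal.ofReal_ne_top), mul_comm]
  exact hmax.trans (ENNReal.ofReal_le_ofReal hle)

/-- **Kolmogorov's maximal inequality.** -/
theorem measure_exists_le_abs_sum_le {ξ : ℕ → Ω → ℝ} [IsProbabilityMeasure P]
    (hind : iIndepFun ξ P)
    (hL2 : ∀ i, MemLp (ξ i) 2 P) (hmean : ∀ i, P[ξ i] = 0) {ε : ℝ} (hε : 0 < ε) (L : ℕ) :
    P {ω | ∃ j ≤ L, ε ≤ |∑ i ∈ Finset.range j, ξ i ω|} ≤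
      ENNReal.ofReal ((∑ i ∈ Finset.range L, Var[ξ i; P]) / ε ^ 2) := by
  -- The natural filtration needs strongly measurable variables, so pass to such versions; the event
  -- changes by a null set only.
  have hae : ∀ i, ξ i =ᵐ[P] (hL2 i).1.mk (ξ i) := fun i => (hL2 i).1.ae_eq_mk
  have h := measure_exists_le_abs_sum_le_of_stronglyMeasurable
    (fun i => (hL2 i).1.stronglyMeasurable_mk)
    (hind.congr hae) (fun i => (memLp_congr_ae (hae i)).1 (hL2 i))
    (fun i => (integral_congr_ae (hae i)).symm.trans (hmean i)) hε L
  have hvar : ∀ i, Var[(hL2 i).1.mk (ξ i); P] = Var[ξ i; P] := fun i =>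
    (variance_congr (hae i)).symm
  simp only [hvar] at h
  refine le_of_eq_of_le (measure_congr ?_) h
  filter_upwards [ae_all_iff.2 hae] with ω hω
  change (∃ j ≤ L, ε ≤ |∑ i ∈ Finset.range j, ξ i ω|) =
    (∃ j ≤ L, ε ≤ |∑ i ∈ Finset.range j, (hL2 i).1.mk (ξ i) ω|)
  simp only [hω]

/-- **Anscombe's theorem**: a random index that stays within `o (b v ^ 2)` of a deterministic one
may be replaced by it in partial sums normalised by `b v`. -/
theorem tendstoInMeasure_sum_randomIndex {ξ : ℕ → Ω → ℝ} [IsProbabilityMeasure P]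
    (hind : iIndepFun ξ P) (hL2 : ∀ i, MemLp (ξ i) 2 P) (hmean : ∀ i, P[ξ i] = 0)
    {s : ℝ} (hvar : ∀ i, Var[ξ i; P] ≤ s)
    {N : ℝ → Ω → ℕ} {n₀ : ℝ → ℕ} {b : ℝ → ℝ} (hb : Tendsto b atTop atTop)
    (hN : TendstoInMeasure P (fun v ω => ((N v ω : ℝ) - n₀ v) / b v ^ 2) atTop 0) :
    TendstoInMeasure P (fun v ω => (∑ i ∈ Finset.range (N v ω), ξ i ω -
      ∑ i ∈ Finset.range (n₀ v), ξ i ω) / b v) atTop 0 := by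
  rw [tendstoInMeasure_iff_norm] at hN ⊢
  intro ε hε
  have hs0 : 0 ≤ s := (variance_nonneg _ _).trans (hvar 0)
  rw [ENNReal.tendsto_nhds_zero]
  intro δ hδ
  rcases eq_or_ne δ ⊤ with rfl | hδt
  · exact Eventually.of_forall fun _ => le_top
  have hδr : 0 < δ.toReal := ENNReal.toReal_pos hδ.ne' hδt
  -- Kolmogorov's bound over 2K ≤ 4η(b v)² terms at level ε(b v)/2 is at most 16ηs/ε², which this η
  -- keeps below δ/2; s + 1 avoids division by zero.
  set η : ℝ := δ.toReal * ε ^ 2 / (32 * (s + 1)) with hη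
  have hηpos : 0 < η := by positivity
  have h1 := (ENNReal.tendsto_nhds_zero.1 (hN η hηpos)) (δ / 2) (ENNReal.half_pos hδ.ne')
  have hb1 : ∀ᶠ v in atTop, 1 ≤ η * b v ^ 2 := by
    have : Tendsto (fun v => η * b v ^ 2) atTop atTop :=
      ((tendsto_pow_atTop two_ne_zero).comp hb).const_mul_atTop hηpos
    exact this.eventually_ge_atTop 1
  filter_upwards [h1, hb1, hb.eventually_gt_atTop 0] with v hv hbv hb0
  set K := ⌈η * b v ^ 2⌉₊ with hK
  -- Left end of a window of length 2K containing both indices; truncation at 0 does no harm. Both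
  -- sums are compared with the sum up to a, each at a cost below ε(b v)/2.
  set a := n₀ v - K with ha
  have hsub : {ω | ε ≤ ‖(∑ i ∈ Finset.range (N v ω), ξ i ω -
      ∑ i ∈ Finset.range (n₀ v), ξ i ω) / b v - (0 : Ω → ℝ) ω‖} ⊆
      {ω | η ≤ ‖((N v ω : ℝ) - n₀ v) / b v ^ 2 - (0 : Ω → ℝ) ω‖} ∪
      {ω | ∃ j ≤ 2 * K, ε * b v / 2 ≤ |∑ i ∈ Finset.range j, ξ (a + i) ω|} := by
    intro ω hω
    by_contra hcon
    simp only [Set.mem_union, Set.mem_ofPred_eq, not_or, not_le, not_exists, not_and,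
      Pi.zero_apply, sub_zero, norm_div, Real.norm_eq_abs, abs_of_pos hb0,
      abs_of_pos (pow_pos hb0 2)] at hcon hω
    obtain ⟨hc1, hc2⟩ := hcon
    rw [div_lt_iff₀ (by positivity)] at hc1
    rw [le_div_iff₀ hb0] at hω
    have hc1' := abs_lt.1 (hc1.trans_le (Nat.le_ceil _))
    have hup : N v ω < n₀ v + K := by
      have : (N v ω : ℝ) < n₀ v + K := by linarith [hc1'.2]
      exact_mod_cast this
    have hlo : n₀ v < N v ω + K := by
      have : (n₀ v : ℝ) < N v ω + K := by linarith [hc1'.1]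
      exact_mod_cast this
    have key : ∀ n, a ≤ n → n ≤ a + 2 * K →
        |∑ i ∈ Finset.range n, ξ i ω - ∑ i ∈ Finset.range a, ξ i ω| < ε * b v / 2 := by
      intro n hn1 hn2
      obtain ⟨j, rfl⟩ := Nat.exists_eq_add_of_le hn1
      rw [Finset.sum_range_add, add_sub_cancel_left]
      exact hc2 j (by omega)
    have k1 := abs_lt.1 (key (N v ω) (by omega) (by omega))
    have k2 := abs_lt.1 (key (n₀ v) (by omega) (by omega))
    have : |∑ i ∈ Finset.range (N v ω), ξ i ω - ∑ i ∈ Finset.range (n₀ v), ξ i ω| < ε * b v := by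
      rw [abs_lt]
      constructor <;> linarith [k1.1, k1.2, k2.1, k2.2]
    linarith
  have hkol := measure_exists_le_abs_sum_le (ξ := fun i => ξ (a + i))
    (hind.precomp (add_right_injective a)) (fun i => hL2 _) (fun i => hmean _)
    (ε := ε * b v / 2) (by positivity) (2 * K)
  have hbound : (∑ i ∈ Finset.range (2 * K), Var[ξ (a + i); P]) / (ε * b v / 2) ^ 2 ≤
      (δ / 2).toReal := by
    have h2 : (∑ i ∈ Finset.range (2 * K), Var[ξ (a + i); P]) ≤ 2 * K * s := by
      refine (Finset.sum_le_card_nsmul _ _ s fun i _ => hvar _).trans ?_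
      simp
    have h3 : (K : ℝ) ≤ 2 * (η * b v ^ 2) := by
      have := (Nat.ceil_lt_add_one (a := η * b v ^ 2) (by positivity)).le
      linarith
    rw [div_le_iff₀ (by positivity), ENNReal.toReal_div, ENNReal.toReal_ofNat]
    refine h2.trans ((mul_le_mul_of_nonneg_right
      (mul_le_mul_of_nonneg_left h3 zero_le_two) hs0).trans ?_)
    rw [hη]
    have h4 : δ.toReal * ε ^ 2 / (32 * (s + 1)) * s ≤ δ.toReal * ε ^ 2 / 32 := by
      rw [div_mul_eq_mul_div, div_le_div_iff₀ (by positivity) (by positivity)]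
      nlinarith [mul_pos hδr (pow_pos hε 2)]
    nlinarith [mul_le_mul_of_nonneg_right h4 (sq_nonneg (b v))]
  calc _ ≤ _ := measure_mono hsub
    _ ≤ _ := measure_union_le _ _
    _ ≤ δ / 2 + δ / 2 := by
      refine add_le_add hv (hkol.trans ?_)
      refine (ENNReal.ofReal_le_ofReal hbound).trans (ENNReal.ofReal_toReal ?_).le
      exact (ENNReal.div_lt_top hδt two_ne_zero).ne
    _ = δ := ENNReal.add_halves δ

end Sums

/-! ### A square-integrable bound for running means -/

section Domination

variable {Ω : Type*} [MeasurableSpace Ω] {P : Measure Ω}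

/-- The running means of independent nonnegative variables with bounded variances are dominated
by a square-integrable variable. -/
theorem exists_memLp_two_sum_le {ξ : ℕ → Ω → ℝ} [IsProbabilityMeasure P]
    (hind : iIndepFun ξ P) (hL2 : ∀ i, MemLp (ξ i) 2 P) (hnonneg : ∀ i ω, 0 ≤ ξ i ω)
    {m s : ℝ} (hmean : ∀ i, P[ξ i] = m) (hvar : ∀ i, Var[ξ i; P] ≤ s) :
    ∃ M : Ω → ℝ, MemLp M 2 P ∧ (∀ ω, 0 ≤ M ω) ∧
      ∀ᵐ ω ∂P, ∀ n : ℕ, 1 ≤ n → ∑ i ∈ Finset.range n, ξ i ω ≤ M ω * n := by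
  have hm0 : 0 ≤ m := by
    rw [← hmean 0]
    exact integral_nonneg fun ω => hnonneg 0 ω
  have hs0 : 0 ≤ s := (variance_nonneg _ _).trans (hvar 0)
  -- Squared deviations of the means at dyadic times have expectations at most s/2ᵏ. Their sum over
  -- k is therefore integrable, and its square root is an L² bound on all dyadic deviations at once.
  set f : ℕ → Ω → ℝ := fun k ω =>
    ((∑ i ∈ Finset.range (2 ^ k), ξ i ω) / 2 ^ k - m) ^ 2 with hf
  have hS2 : ∀ n, MemLp (fun ω => ∑ i ∈ Finset.range n, ξ i ω) 2 P := fun n =>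
    memLp_finsetSum _ fun i _ => hL2 i
  have hfL2 : ∀ k, MemLp (fun ω => (∑ i ∈ Finset.range (2 ^ k), ξ i ω) / 2 ^ k - m) 2 P := by
    intro k
    simp only [div_eq_mul_inv]
    exact ((hS2 (2 ^ k)).mul_const ((2 : ℝ) ^ k)⁻¹).sub (memLp_const m)
  have hfint : ∀ k, Integrable (f k) P := fun k => (hfL2 k).integrable_sq
  have hfle : ∀ k, ∫ ω, f k ω ∂P ≤ s * (1 / 2) ^ k := by
    intro k
    have hmeanS : ∫ ω, ∑ i ∈ Finset.range (2 ^ k), ξ i ω ∂P = 2 ^ k * m := by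
      rw [integral_finsetSum _ fun i _ => (hL2 i).integrable one_le_two]
      simp [hmean]
    have h1 : ∫ ω, f k ω ∂P =
        ((2 : ℝ) ^ k)⁻¹ ^ 2 * Var[fun ω => ∑ i ∈ Finset.range (2 ^ k), ξ i ω; P] := by
      rw [variance_eq_integral (hS2 _).aemeasurable, hmeanS, ← integral_const_mul]
      refine integral_congr_ae (Eventually.of_forall fun ω => ?_)
      simp only [hf]
      field_simp
    rw [h1, variance_sum_range_of_iIndepFun hind hL2]
    have h2 : ∑ i ∈ Finset.range (2 ^ k), Var[ξ i; P] ≤ 2 ^ k * s := by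
      refine (Finset.sum_le_card_nsmul _ _ s fun i _ => hvar _).trans ?_
      simp
    refine (mul_le_mul_of_nonneg_left h2 (by positivity)).trans (le_of_eq ?_)
    rw [one_div, inv_pow (2 : ℝ) k]
    field_simp
  set E : Ω → ENNReal := fun ω => ∑' k, ENNReal.ofReal (f k ω) with hE
  have hEmeas : AEMeasurable E P := by
    refine AEMeasurable.tsum fun k => ?_
    exact (hfint k).aemeasurable.ennreal_ofReal
  have hEint : ∫⁻ ω, E ω ∂P ≠ ⊤ := by
    rw [hE, lintegral_tsum fun k => (hfint k).aemeasurable.ennreal_ofReal]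
    have hle : ∑' k, ∫⁻ ω, ENNReal.ofReal (f k ω) ∂P ≤
        ∑' k, ENNReal.ofReal (s * (1 / 2) ^ k) := by
      refine ENNReal.tsum_le_tsum fun k => ?_
      rw [← ofReal_integral_eq_lintegral_ofReal (hfint k)
        (Eventually.of_forall fun ω => sq_nonneg _)]
      exact ENNReal.ofReal_le_ofReal (hfle k)
    refine ne_top_of_le_ne_top ?_ hle
    exact (summable_geometric_two.mul_left s).tsum_ofReal_ne_top
  have hDint : Integrable (fun ω => (E ω).toReal) P := integrable_toReal_of_lintegral_ne_top hEmeas hEint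
  have hsqrt : MemLp (fun ω => √(E ω).toReal) 2 P := by
    rw [memLp_two_iff_integrable_sq hDint.aemeasurable.sqrt.aestronglyMeasurable]
    simpa only [Real.sq_sqrt ENNReal.toReal_nonneg] using hDint
  refine ⟨fun ω => 2 * (m + √(E ω).toReal), ?_, fun ω => by positivity, ?_⟩
  · exact ((memLp_const m).add hsqrt).const_mul 2
  filter_upwards [ae_lt_top' hEmeas hEint] with ω hω n hn
  -- By nonnegativity the sum up to n is at most the sum up to the next power of two, which is at
  -- most 2n; hence the factor 2 in the bound.
  set k := Nat.clog 2 n with hk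
  have hnk : n ≤ 2 ^ k := Nat.le_pow_clog one_lt_two n
  have hkn : (2 : ℝ) ^ k ≤ 2 * n := by
    rcases Nat.eq_or_lt_of_le hn with h1 | h1
    · have : k = 0 := by rw [hk, ← h1, Nat.clog_one_right]
      rw [this, ← h1]
      norm_num
    · have h2 : 2 ^ (k - 1) < n := Nat.pow_pred_clog_lt_self one_lt_two h1
      have h3 : 1 ≤ k := Nat.clog_pos one_lt_two h1
      have h4 : 2 ^ k = 2 * 2 ^ (k - 1) := by rw [← pow_succ', Nat.sub_add_cancel h3]
      have h5 : 2 ^ k ≤ 2 * n := by omega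
      exact_mod_cast h5
  have hfE : f k ω ≤ (E ω).toReal := by
    rw [← ENNReal.ofReal_le_iff_le_toReal hω.ne]
    exact ENNReal.le_tsum k
  have habs : (∑ i ∈ Finset.range (2 ^ k), ξ i ω) / 2 ^ k - m ≤ √(E ω).toReal :=
    Real.le_sqrt_of_sq_le hfE
  calc ∑ i ∈ Finset.range n, ξ i ω ≤ ∑ i ∈ Finset.range (2 ^ k), ξ i ω :=
        Finset.sum_le_sum_of_subset_of_nonneg (Finset.range_mono hnk) fun i _ _ => hnonneg i ω
    _ = (∑ i ∈ Finset.range (2 ^ k), ξ i ω) / 2 ^ k * 2 ^ k := by field_simp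
    _ ≤ (m + √(E ω).toReal) * 2 ^ k := by gcongr; linarith
    _ ≤ (m + √(E ω).toReal) * (2 * n) := by gcongr
    _ = _ := by ring

end Domination

/-! ### Independence and identical distribution of functions of the pairs -/

section Pairs

variable {Ω : Type*} [MeasurableSpace Ω] {P : Measure Ω}

/-- Grouping independent variables indexed by pairs. -/
theorem iIndepFun_curry {ι κ : Type*} [Countable ι] [Countable κ] [IsProbabilityMeasure P]
    {X : ι → κ → Ω → ℝ} (hm : ∀ i j, AEMeasurable (X i j) P)
    (h : iIndepFun (fun (p : ι × κ) ω => X p.1 p.2 ω) P) :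
    iIndepFun (fun i ω j => X i j ω) P := by
  have hprob : ∀ i j, IsProbabilityMeasure (P.map (X i j)) := fun i j =>
    Measure.isProbabilityMeasure_map (hm i j)
  have hrow : ∀ i, P.map (fun ω j => X i j ω) = Measure.infinitePi fun j => P.map (X i j) :=
    fun i => (h.precomp (g := fun j => (i, j))
      (Prod.mk_right_injective i)).map_fun_eq_infinitePi_map₀' (hm i)
  have hjm : AEMeasurable (fun ω (p : ι × κ) => X p.1 p.2 ω) P :=
    aemeasurable_pi_lambda _ fun p => hm p.1 p.2
  have hjoint : P.map (fun ω (p : ι × κ) => X p.1 p.2 ω) =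
      Measure.infinitePi fun p : ι × κ => P.map (X p.1 p.2) :=
    h.map_fun_eq_infinitePi_map₀' fun p => hm p.1 p.2
  rw [iIndepFun_iff_map_fun_eq_infinitePi_map₀' fun i => aemeasurable_pi_lambda _ (hm i)]
  simp only [hrow]
  -- Independence says that the joint law is a product measure, and currying carries a product over
  -- pairs to a product of products.
  rw [← Measure.infinitePi_map_curry (fun i j => P.map (X i j)), ← hjoint,
    AEMeasurable.map_map_of_aemeasurable (MeasurableEquiv.measurable _).aemeasurable hjm]
  rfl

/-- Reindexing `ℕ ⊕ ℕ` by `ℕ × Bool` puts X_i and Y_i in one row; rows are independent by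
`iIndepFun_curry`. -/
theorem iIndepFun_pair_comp [IsProbabilityMeasure P] {X Y : ℕ → Ω → ℝ}
    (hX : ∀ i, AEMeasurable (X i) P) (hY : ∀ i, AEMeasurable (Y i) P)
    (h : iIndepFun (Sum.elim X Y) P) {g : ℝ → ℝ → ℝ} (hg : Measurable fun z : ℝ × ℝ => g z.1 z.2) :
    iIndepFun (fun i ω => g (X i ω) (Y i ω)) P := by
  let W : ℕ → Bool → Ω → ℝ := fun i b => cond b (X i) (Y i)
  let e : ℕ × Bool → ℕ ⊕ ℕ := fun p => cond p.2 (Sum.inl p.1) (Sum.inr p.1)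
  have he : Function.Injective e := by
    rintro ⟨i, _ | _⟩ ⟨j, _ | _⟩ hij <;> simp_all [e]
  have hW : iIndepFun (fun (p : ℕ × Bool) ω => W p.1 p.2 ω) P := by
    convert! h.precomp he using 2 with p
    rcases p with ⟨i, _ | _⟩ <;> rfl
  have hWm : ∀ i b, AEMeasurable (W i b) P := by
    rintro i (_ | _)
    exacts [hY i, hX i]
  have hgm : Measurable fun w : Bool → ℝ => g (w true) (w false) :=
    hg.comp (g := fun z : ℝ × ℝ => g z.1 z.2) (f := fun w : Bool → ℝ => (w true, w false))
      ((measurable_pi_apply true).prodMk (measurable_pi_apply false))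
  exact (iIndepFun_curry hWm hW).comp (fun _ w => g (w true) (w false)) fun _ => hgm

theorem indepFun_pair {X Y : ℕ → Ω → ℝ} (h : iIndepFun (Sum.elim X Y) P) (i j : ℕ) :
    IndepFun (X i) (Y j) P :=
  h.indepFun (i := Sum.inl i) (j := Sum.inr j) Sum.inl_ne_inr

theorem identDistrib_pair_comp [IsProbabilityMeasure P] {X Y : ℕ → Ω → ℝ}
    (hX : ∀ i, IdentDistrib (X i) (X 0) P P) (hY : ∀ i, IdentDistrib (Y i) (Y 0) P P)
    (h : iIndepFun (Sum.elim X Y) P) {g : ℝ → ℝ → ℝ} (hg : Measurable fun z : ℝ × ℝ => g z.1 z.2)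
    (i : ℕ) :
    IdentDistrib (fun ω => g (X i ω) (Y i ω)) (fun ω => g (X 0 ω) (Y 0 ω)) P P :=
  ((hX i).prodMk (hY i) (indepFun_pair h i i) (indepFun_pair h 0 0)).comp hg

end Pairs

open scoped NNReal

/-! ### Gaussian moments up to order four -/

section GaussianMoments

theorem moments_gaussianReal_zero (v : ℝ≥0) :
    ∫ x, x ^ 3 ∂gaussianReal 0 v = 0 ∧ ∫ x, x ^ 4 ∂gaussianReal 0 v = 3 * (v : ℝ) ^ 2 := by
  have hmom : ∀ k : ℕ, ∫ x, x ^ k ∂gaussianReal 0 v =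
      iteratedDeriv k (fun t : ℝ => Real.exp (v * t ^ 2 / 2)) 0 := by
    intro k
    have h := iteratedDeriv_mgf_zero (X := fun x : ℝ => x) (μ := gaussianReal 0 v) (by simp) k
    rw [mgf_fun_id_gaussianReal] at h
    simp only [zero_mul, zero_add] at h
    exact h.symm
  -- Derivatives of the moment generating function keep the form polynomial times exponential, with
  -- p replaced by p' + p·vt.
  have hstep : ∀ p q : ℝ → ℝ, (∀ t, HasDerivAt p (q t) t) →
      deriv (fun t => p t * Real.exp (v * t ^ 2 / 2)) =
        fun t => (q t + p t * (v * t)) * Real.exp (v * t ^ 2 / 2) := by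
    intro p q hpq
    ext t
    have he : HasDerivAt (fun t : ℝ => Real.exp (v * t ^ 2 / 2))
        (Real.exp (v * t ^ 2 / 2) * (v * t)) t := by
      have h1 : HasDerivAt (fun t : ℝ => (v : ℝ) * t ^ 2 / 2) (v * t) t := by
        have := ((hasDerivAt_pow 2 t).const_mul (v : ℝ)).div_const 2
        convert! this using 1
        simp
        ring
      exact h1.exp
    rw [((hpq t).fun_mul he).deriv]
    ring
  have h0 : (fun t : ℝ => Real.exp (v * t ^ 2 / 2)) =
      fun t => (fun _ => (1 : ℝ)) t * Real.exp (v * t ^ 2 / 2) := by simp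
  -- The polynomials stay unsimplified so that each one matches the output of the previous step.
  have h1 := hstep (fun _ => 1) (fun _ => 0) (fun t => hasDerivAt_const t 1)
  have h2 := hstep (fun t => 0 + 1 * (v * t)) (fun _ => v) (fun t => by
    simpa using (hasDerivAt_id t).const_mul (v : ℝ))
  have h3 := hstep (fun t => v + (0 + 1 * (v * t)) * (v * t)) (fun t => 2 * v ^ 2 * t) (fun t => by
    have := ((hasDerivAt_pow 2 t).const_mul ((v : ℝ) ^ 2)).const_add (v : ℝ)
    convert! this using 1
    · ext; ring
    · simp; ring)
  have h4 := hstep (fun t => 2 * v ^ 2 * t + (v + (0 + 1 * (v * t)) * (v * t)) * (v * t))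
    (fun t => 3 * v ^ 2 + 3 * v ^ 3 * t ^ 2) (fun t => by
    have := ((hasDerivAt_id t).const_mul (3 * (v : ℝ) ^ 2)).add
      ((hasDerivAt_pow 3 t).const_mul ((v : ℝ) ^ 3))
    convert! this using 1
    · ext; simp; ring
    · simp; ring)
  constructor
  · rw [hmom, h0, iteratedDeriv_succ, iteratedDeriv_succ, iteratedDeriv_one, h1, h2, h3]
    simp
  · rw [hmom, h0, iteratedDeriv_succ, iteratedDeriv_succ, iteratedDeriv_succ, iteratedDeriv_one,
      h1, h2, h3, h4]
    simp

theorem integrable_pow_gaussianReal (a : ℝ) (v : ℝ≥0) (k : ℕ) :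
    Integrable (fun x : ℝ => x ^ k) (gaussianReal a v) :=
  integrable_pow_of_mem_interior_integrableExpSet (X := fun x : ℝ => x) (by simp) k

theorem integral_sq_and_pow_four_gaussianReal (a : ℝ) (v : ℝ≥0) :
    ∫ x, x ^ 2 ∂gaussianReal a v = v + a ^ 2 ∧
      ∫ x, x ^ 4 ∂gaussianReal a v = a ^ 4 + 6 * a ^ 2 * v + 3 * (v : ℝ) ^ 2 := by
  have hshift : ∀ k : ℕ, ∫ x, x ^ k ∂gaussianReal a v = ∫ z, (z + a) ^ k ∂gaussianReal 0 v := by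
    intro k
    have h := gaussianReal_map_add_const (μ := 0) (v := v) a
    rw [zero_add] at h
    rw [← h, integral_map (by fun_prop) (by fun_prop)]
  have hI := integrable_pow_gaussianReal 0 v
  have h1 : ∫ z, z ∂gaussianReal 0 v = 0 := integral_id_gaussianReal
  have h2 : ∫ z, z ^ 2 ∂gaussianReal 0 v = v := by
    have := variance_fun_id_gaussianReal (μ := 0) (v := v)
    rwa [variance_of_integral_eq_zero (by fun_prop) h1] at this
  obtain ⟨h3, h4⟩ := moments_gaussianReal_zero v
  have hI1 : Integrable (fun z : ℝ => z) (gaussianReal 0 v) := by simpa using hI 1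
  constructor
  · rw [hshift]
    have he : ∀ z : ℝ, (z + a) ^ 2 = z ^ 2 + (2 * a * z + a ^ 2) := fun z => by ring
    simp only [he]
    have hlin : Integrable (fun z => 2 * a * z + a ^ 2) (gaussianReal 0 v) :=
      (hI1.const_mul _).add (integrable_const _)
    rw [integral_add (hI 2) hlin,
      integral_add (hI1.const_mul _) (integrable_const _), integral_const_mul, h1, h2]
    simp
  · rw [hshift]
    have he : ∀ z : ℝ, (z + a) ^ 4 =
        z ^ 4 + (4 * a * z ^ 3 + (6 * a ^ 2 * z ^ 2 + (4 * a ^ 3 * z + a ^ 4))) := fun z => by ring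
    simp only [he]
    have i0 := integrable_const (μ := gaussianReal 0 v) (a ^ 4)
    have i1 := hI1.const_mul (4 * a ^ 3)
    have i2 := (hI 2).const_mul (6 * a ^ 2)
    have i3 := (hI 3).const_mul (4 * a)
    have j1 : Integrable (fun z => 4 * a ^ 3 * z + a ^ 4) (gaussianReal 0 v) := i1.add i0
    have j2 : Integrable (fun z => 6 * a ^ 2 * z ^ 2 + (4 * a ^ 3 * z + a ^ 4))
      (gaussianReal 0 v) := i2.add j1
    have j3 : Integrable (fun z => 4 * a * z ^ 3 + (6 * a ^ 2 * z ^ 2 + (4 * a ^ 3 * z + a ^ 4)))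
      (gaussianReal 0 v) := i3.add j2
    rw [integral_add (hI 4) j3, integral_add i3 j2, integral_add i2 j1, integral_add i1 i0, integral_const_mul, integral_const_mul,
      integral_const_mul, h1, h2, h3, h4]
    simp
    ring

variable {Ω : Type*} [MeasurableSpace Ω] {P : Measure Ω}

theorem memLp_two_gaussian {U : Ω → ℝ} {a : ℝ} {v : ℝ≥0}
    (hU : HasLaw U (gaussianReal a v) P) : MemLp U 2 P := by
  rw [memLp_two_iff_integrable_sq hU.aemeasurable.aestronglyMeasurable]
  have h := integrable_pow_gaussianReal a v 2
  rw [← hU.map_eq] at h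
  exact h.comp_aemeasurable hU.aemeasurable

theorem memLp_two_sq_gaussian {U : Ω → ℝ} {a : ℝ} {v : ℝ≥0}
    (hU : HasLaw U (gaussianReal a v) P) : MemLp (fun ω => U ω ^ 2) 2 P := by
  rw [memLp_two_iff_integrable_sq (hU.aemeasurable.pow_const 2).aestronglyMeasurable]
  have h := integrable_pow_gaussianReal a v 4
  rw [← hU.map_eq] at h
  have h' := h.comp_aemeasurable hU.aemeasurable
  refine h'.congr (Eventually.of_forall fun ω => ?_)
  simp only [Function.comp]
  ring

theorem integral_sq_gaussian {U : Ω → ℝ} {a : ℝ} {v : ℝ≥0}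
    (hU : HasLaw U (gaussianReal a v) P) : ∫ ω, U ω ^ 2 ∂P = v + a ^ 2 := by
  rw [← (integral_sq_and_pow_four_gaussianReal a v).1]
  exact hU.integral_comp (f := fun x : ℝ => x ^ 2) (by fun_prop)

theorem variance_sq_gaussian [IsProbabilityMeasure P] {U : Ω → ℝ} {a : ℝ} {v : ℝ≥0}
    (hU : HasLaw U (gaussianReal a v) P) :
    Var[fun ω => U ω ^ 2; P] = 2 * (v : ℝ) ^ 2 + 4 * v * a ^ 2 := by
  have h4 : ∫ ω, U ω ^ 4 ∂P = a ^ 4 + 6 * a ^ 2 * v + 3 * (v : ℝ) ^ 2 := by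
    rw [← (integral_sq_and_pow_four_gaussianReal a v).2]
    exact hU.integral_comp (f := fun x : ℝ => x ^ 4) (by fun_prop)
  rw [variance_eq_sub (memLp_two_sq_gaussian hU), integral_sq_gaussian hU]
  simp only [Pi.pow_apply, ← pow_mul, Nat.reduceMul, h4]
  ring

/-- Independent variables agree almost nowhere if one of them has an atomless law. -/
theorem ae_ne_of_indepFun [IsProbabilityMeasure P] {U V : Ω → ℝ} (hU : AEMeasurable U P) (hV : AEMeasurable V P)
    (hind : IndepFun U V P) [NullSingletonClass (P.map V)] : ∀ᵐ ω ∂P, U ω ≠ V ω := by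
  have hprod := (indepFun_iff_map_prod_eq_prod_map_map hU hV).1 hind
  have hd : MeasurableSet {z : ℝ × ℝ | z.1 ≠ z.2} :=
    (measurableSet_eq_fun measurable_fst measurable_snd).compl
  have : IsProbabilityMeasure (P.map U) := Measure.isProbabilityMeasure_map hU
  have : IsProbabilityMeasure (P.map V) := Measure.isProbabilityMeasure_map hV
  have h : ∀ᵐ z ∂((P.map U).prod (P.map V)), z.1 ≠ z.2 := by
    rw [Measure.ae_prod_iff_ae_ae hd]
    refine Eventually.of_forall fun x => ?_
    filter_upwards [compl_mem_ae_iff.2 (measure_singleton (μ := P.map V) x)] with y hy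
    exact fun h => hy h.symm
  rw [← hprod, ae_map_iff (hU.prodMk hV) hd] at h
  exact h

end GaussianMoments

/-! ### The Gaussian model: laws of large numbers and moments of the sample size -/

/-- Two independent samples of independent normal variables with common variance `σ ^ 2`. -/
structure IsTwoSampleGaussian {Ω : Type*} [MeasurableSpace Ω] (P : Measure Ω) (μ₁ μ₂ σ : ℝ)
    (X Y : ℕ → Ω → ℝ) : Prop where
  hasLaw_left : ∀ i, HasLaw (X i) (gaussianReal μ₁ (σ ^ 2).toNNReal) P
  hasLaw_right : ∀ i, HasLaw (Y i) (gaussianReal μ₂ (σ ^ 2).toNNReal) P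
  indep : iIndepFun (Sum.elim X Y) P

/-- The sum of the squared deviations of `X i` and `Y i` from `m`. -/
def pairSq {Ω : Type*} (X Y : ℕ → Ω → ℝ) (m : ℝ) (i : ℕ) (ω : Ω) : ℝ :=
  (X i ω - m) ^ 2 + (Y i ω - m) ^ 2

/-- The sum of the deviations of `X i` and `Y i` from `m`. -/
def pairDev {Ω : Type*} (X Y : ℕ → Ω → ℝ) (m : ℝ) (i : ℕ) (ω : Ω) : ℝ :=
  X i ω + Y i ω - 2 * m

namespace IsTwoSampleGaussian

variable {Ω : Type*} [MeasurableSpace Ω] {P : Measure Ω}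
  {μ₁ μ₂ σ : ℝ} {X Y : ℕ → Ω → ℝ}

theorem aemeasurable_left (h : IsTwoSampleGaussian P μ₁ μ₂ σ X Y) (i : ℕ) :
    AEMeasurable (X i) P := (h.hasLaw_left i).aemeasurable

theorem aemeasurable_right (h : IsTwoSampleGaussian P μ₁ μ₂ σ X Y) (i : ℕ) :
    AEMeasurable (Y i) P := (h.hasLaw_right i).aemeasurable

theorem identDistrib_left (h : IsTwoSampleGaussian P μ₁ μ₂ σ X Y) (i : ℕ) :
    IdentDistrib (X i) (X 0) P P :=
  ⟨h.aemeasurable_left i, h.aemeasurable_left 0,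
    (h.hasLaw_left i).map_eq.trans (h.hasLaw_left 0).map_eq.symm⟩

theorem identDistrib_right (h : IsTwoSampleGaussian P μ₁ μ₂ σ X Y) (i : ℕ) :
    IdentDistrib (Y i) (Y 0) P P :=
  ⟨h.aemeasurable_right i, h.aemeasurable_right 0,
    (h.hasLaw_right i).map_eq.trans (h.hasLaw_right 0).map_eq.symm⟩

theorem iIndepFun_pairSq [IsProbabilityMeasure P] (h : IsTwoSampleGaussian P μ₁ μ₂ σ X Y) (m : ℝ) :
    iIndepFun (pairSq X Y m) P :=
  iIndepFun_pair_comp (g := fun x y => (x - m) ^ 2 + (y - m) ^ 2) h.aemeasurable_left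
    h.aemeasurable_right h.indep (by fun_prop)

theorem identDistrib_pairSq [IsProbabilityMeasure P] (h : IsTwoSampleGaussian P μ₁ μ₂ σ X Y) (m : ℝ) (i : ℕ) :
    IdentDistrib (pairSq X Y m i) (pairSq X Y m 0) P P :=
  identDistrib_pair_comp (g := fun x y => (x - m) ^ 2 + (y - m) ^ 2) h.identDistrib_left
    h.identDistrib_right h.indep (by fun_prop) i

theorem iIndepFun_pairDev [IsProbabilityMeasure P] (h : IsTwoSampleGaussian P μ₁ μ₂ σ X Y) (m : ℝ) :
    iIndepFun (pairDev X Y m) P :=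
  iIndepFun_pair_comp (g := fun x y => x + y - 2 * m) h.aemeasurable_left
    h.aemeasurable_right h.indep (by fun_prop)

theorem identDistrib_pairDev [IsProbabilityMeasure P] (h : IsTwoSampleGaussian P μ₁ μ₂ σ X Y) (m : ℝ) (i : ℕ) :
    IdentDistrib (pairDev X Y m i) (pairDev X Y m 0) P P :=
  identDistrib_pair_comp (g := fun x y => x + y - 2 * m) h.identDistrib_left
    h.identDistrib_right h.indep (by fun_prop) i

theorem memLp_pairSq (h : IsTwoSampleGaussian P μ₁ μ₂ σ X Y) (m : ℝ) (i : ℕ) :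
    MemLp (pairSq X Y m i) 2 P :=
  (memLp_two_sq_gaussian (gaussianReal_sub_const (h.hasLaw_left i) m)).add
    (memLp_two_sq_gaussian (gaussianReal_sub_const (h.hasLaw_right i) m))

theorem aemeasurable_stopNReal (h : IsTwoSampleGaussian P μ₁ μ₂ σ X Y) (n₁ : ℕ) (v : ℝ) :
    AEMeasurable (stopNReal X Y n₁ v) P :=
  _root_.aemeasurable_stopNReal h.aemeasurable_left h.aemeasurable_right n₁ v

variable [IsProbabilityMeasure P]

theorem memLp_pairDev (h : IsTwoSampleGaussian P μ₁ μ₂ σ X Y) (m : ℝ) (i : ℕ) :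
    MemLp (pairDev X Y m i) 2 P :=
  ((memLp_two_gaussian (h.hasLaw_left i)).add (memLp_two_gaussian (h.hasLaw_right i))).sub
    (memLp_const (2 * m))

/-- At the midpoint the two shifted means are ±(μ₁ - μ₂)/2, so both groups contribute equally. -/
theorem integral_pairSq (h : IsTwoSampleGaussian P μ₁ μ₂ σ X Y) (i : ℕ) :
    P[pairSq X Y ((μ₁ + μ₂) / 2) i] = 2 * (σ ^ 2 + (μ₁ - μ₂) ^ 2 / 4) := by
  have hl := gaussianReal_sub_const (h.hasLaw_left i) ((μ₁ + μ₂) / 2)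
  have hr := gaussianReal_sub_const (h.hasLaw_right i) ((μ₁ + μ₂) / 2)
  have hsplit : P[pairSq X Y ((μ₁ + μ₂) / 2) i] =
      ∫ ω, (X i ω - (μ₁ + μ₂) / 2) ^ 2 ∂P + ∫ ω, (Y i ω - (μ₁ + μ₂) / 2) ^ 2 ∂P :=
    integral_add ((memLp_two_sq_gaussian hl).integrable one_le_two)
      ((memLp_two_sq_gaussian hr).integrable one_le_two)
  rw [hsplit, integral_sq_gaussian hl, integral_sq_gaussian hr, Real.coe_toNNReal _ (sq_nonneg σ)]
  ring

theorem variance_pairSq (h : IsTwoSampleGaussian P μ₁ μ₂ σ X Y) (i : ℕ) :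
    Var[pairSq X Y ((μ₁ + μ₂) / 2) i; P] = 4 * σ ^ 4 + 2 * σ ^ 2 * (μ₁ - μ₂) ^ 2 := by
  have hl := gaussianReal_sub_const (h.hasLaw_left i) ((μ₁ + μ₂) / 2)
  have hr := gaussianReal_sub_const (h.hasLaw_right i) ((μ₁ + μ₂) / 2)
  have hind : IndepFun (fun ω => (X i ω - (μ₁ + μ₂) / 2) ^ 2)
      (fun ω => (Y i ω - (μ₁ + μ₂) / 2) ^ 2) P :=
    (indepFun_pair h.indep i i).comp (φ := fun x => (x - (μ₁ + μ₂) / 2) ^ 2)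
      (ψ := fun x => (x - (μ₁ + μ₂) / 2) ^ 2) (by fun_prop) (by fun_prop)
  have hsplit : Var[pairSq X Y ((μ₁ + μ₂) / 2) i; P] = _ :=
    hind.variance_fun_add (memLp_two_sq_gaussian hl) (memLp_two_sq_gaussian hr)
  rw [hsplit, variance_sq_gaussian hl, variance_sq_gaussian hr, Real.coe_toNNReal _ (sq_nonneg σ)]
  ring

theorem integral_pairDev (h : IsTwoSampleGaussian P μ₁ μ₂ σ X Y) (i : ℕ) :
    P[pairDev X Y ((μ₁ + μ₂) / 2) i] = 0 := by
  have hl : ∫ ω, X i ω ∂P = μ₁ := (h.hasLaw_left i).integral_eq.trans integral_id_gaussianReal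
  have hr : ∫ ω, Y i ω ∂P = μ₂ := (h.hasLaw_right i).integral_eq.trans integral_id_gaussianReal
  have il := (memLp_two_gaussian (h.hasLaw_left i)).integrable one_le_two
  have ir := (memLp_two_gaussian (h.hasLaw_right i)).integrable one_le_two
  have hsum : Integrable (fun ω => X i ω + Y i ω) P := il.add ir
  simp only [pairDev]
  rw [integral_sub hsum (integrable_const _), integral_add il ir, hl, hr]
  simp
  ring

/-- Strong law for both sums: after division by n the correction is half the square of the mean
deviation, which tends to 0. -/
theorem ae_tendsto_blindVar (h : IsTwoSampleGaussian P μ₁ μ₂ σ X Y) :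
    ∀ᵐ ω ∂P, Tendsto (blindVar (fun i => X i ω) fun i => Y i ω) atTop
      (𝓝 (σ ^ 2 + (μ₁ - μ₂) ^ 2 / 4)) := by
  set m := (μ₁ + μ₂) / 2 with hm
  have h1 := strong_law_ae_real (pairSq X Y m) ((h.memLp_pairSq m 0).integrable one_le_two)
    (fun i j hij => (h.iIndepFun_pairSq m).indepFun hij) (h.identDistrib_pairSq m)
  have h2 := strong_law_ae_real (pairDev X Y m) ((h.memLp_pairDev m 0).integrable one_le_two)
    (fun i j hij => (h.iIndepFun_pairDev m).indepFun hij) (h.identDistrib_pairDev m)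
  rw [h.integral_pairSq] at h1
  rw [h.integral_pairDev] at h2
  filter_upwards [h1, h2] with ω hω1 hω2
  have hinv : Tendsto (fun n : ℕ => ((n : ℝ))⁻¹) atTop (𝓝 0) := tendsto_inv_atTop_nhds_zero_nat
  have hlim := (hω1.sub ((hω2.pow 2).div_const 2)).div
    ((tendsto_const_nhds (x := (2 : ℝ))).sub hinv) (by norm_num)
  have hval : (2 * (σ ^ 2 + (μ₁ - μ₂) ^ 2 / 4) - 0 ^ 2 / 2) / (2 - 0) =
      σ ^ 2 + (μ₁ - μ₂) ^ 2 / 4 := by ring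
  rw [hval] at hlim
  refine hlim.congr' ?_
  filter_upwards [eventually_ge_atTop 1] with n hn
  have hn0 : (n : ℝ) ≠ 0 := by positivity
  have h3 := (two_mul_sub_one_pos hn).ne'
  have h4 : (2 : ℝ) - (n : ℝ)⁻¹ = (2 * n - 1) / n := by field_simp
  rw [blindVar_eq_centered _ _ m hn, Pi.div_apply, h4]
  simp only [pairSq, pairDev]
  field_simp

theorem ae_blindVar_pos (h : IsTwoSampleGaussian P μ₁ μ₂ σ X Y) (hσ : 0 < σ) :
    ∀ᵐ ω ∂P, ∀ n, 1 ≤ n → 0 < blindVar (fun i => X i ω) (fun i => Y i ω) n := by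
  have : NullSingletonClass (P.map (Y 0)) := by
    rw [(h.hasLaw_right 0).map_eq]
    exact nullSingletonClass_gaussianReal (by positivity)
  filter_upwards [ae_ne_of_indepFun (h.aemeasurable_left 0) (h.aemeasurable_right 0)
    (indepFun_pair h.indep 0 0)] with ω hω n hn
  exact blindVar_pos hω hn

/-- M and the exceptional null set do not depend on v, which gives finiteness for all v at once and
a single dominating variable. -/
theorem exists_memLp_two_bound (h : IsTwoSampleGaussian P μ₁ μ₂ σ X Y) {n₁ : ℕ} (hn₁ : 1 ≤ n₁) :
    ∃ M : Ω → ℝ, MemLp M 2 P ∧ (∀ ω, 0 ≤ M ω) ∧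
      ∀ᵐ ω ∂P, ∀ v : ℝ, 0 < v → stopN X Y n₁ v ω < ⊤ ∧
        stopNReal X Y n₁ v ω ≤ n₁ + 1 + M ω * v := by
  set m := (μ₁ + μ₂) / 2 with hm
  obtain ⟨M, hM2, hM0, hM⟩ := exists_memLp_two_sum_le (h.iIndepFun_pairSq m) (h.memLp_pairSq m)
    (fun i ω => add_nonneg (sq_nonneg _) (sq_nonneg _)) h.integral_pairSq
    (fun i => (h.variance_pairSq i).le)
  refine ⟨M, hM2, hM0, ?_⟩
  filter_upwards [hM] with ω hω v hv
  exact blindSampleSize_le hn₁ (hM0 ω) hv hω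

theorem memLp_two_stopNReal (h : IsTwoSampleGaussian P μ₁ μ₂ σ X Y) {n₁ : ℕ} (hn₁ : 1 ≤ n₁)
    {v : ℝ} (hv : 0 < v) : MemLp (stopNReal X Y n₁ v) 2 P := by
  obtain ⟨M, hM2, hM0, hM⟩ := h.exists_memLp_two_bound hn₁
  have hbound : MemLp (fun ω => (n₁ : ℝ) + 1 + M ω * v) 2 P :=
    (memLp_const ((n₁ : ℝ) + 1)).add (hM2.mul_const v)
  refine hbound.mono (h.aemeasurable_stopNReal n₁ v).aestronglyMeasurable ?_
  filter_upwards [hM] with ω hω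
  have h0 : 0 ≤ stopNReal X Y n₁ v ω := Nat.cast_nonneg _
  rw [Real.norm_of_nonneg h0]
  exact (hω v hv).2.trans (le_abs_self _)

theorem ae_tendsto_stopNReal_atTop (h : IsTwoSampleGaussian P μ₁ μ₂ σ X Y) (hσ : 0 < σ) {n₁ : ℕ}
    (hn₁ : 1 ≤ n₁) : ∀ᵐ ω ∂P, Tendsto (fun v : ℝ => stopNReal X Y n₁ v ω) atTop atTop := by
  filter_upwards [h.ae_tendsto_blindVar, h.ae_blindVar_pos hσ] with ω h1 h2
  exact tendsto_natCast_atTop_atTop.comp (tendsto_blindSampleSize_toNat_atTop hn₁ h2 h1)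

theorem ae_tendsto_stopNReal_div (h : IsTwoSampleGaussian P μ₁ μ₂ σ X Y) (hσ : 0 < σ) {n₁ : ℕ}
    (hn₁ : 1 ≤ n₁) : ∀ᵐ ω ∂P, Tendsto (fun v : ℝ => stopNReal X Y n₁ v ω / v) atTop
      (𝓝 (σ ^ 2 + (μ₁ - μ₂) ^ 2 / 4)) := by
  filter_upwards [h.ae_tendsto_blindVar, h.ae_blindVar_pos hσ] with ω h1 h2
  exact tendsto_blindSampleSize_div hn₁ h2 h1

theorem ae_tendsto_stopNReal_div_nReq (h : IsTwoSampleGaussian P μ₁ μ₂ σ X Y) (hσ : 0 < σ)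
    {n₁ : ℕ} (hn₁ : 1 ≤ n₁) : ∀ᵐ ω ∂P,
      Tendsto (fun v : ℝ => stopNReal X Y n₁ v ω / nReq v σ) atTop
        (𝓝 (1 + (μ₁ - μ₂) ^ 2 / (4 * σ ^ 2))) := by
  filter_upwards [h.ae_tendsto_stopNReal_div hσ hn₁] with ω h1
  have h2 := h1.div_const (σ ^ 2)
  have hval : (σ ^ 2 + (μ₁ - μ₂) ^ 2 / 4) / σ ^ 2 = 1 + (μ₁ - μ₂) ^ 2 / (4 * σ ^ 2) := by
    field_simp
  simpa only [hval, nReq, div_div] using h2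

/-- For `v ≥ 1` the normalised sample sizes have a common square-integrable bound. -/
theorem exists_memLp_two_bound_div_nReq (h : IsTwoSampleGaussian P μ₁ μ₂ σ X Y) (hσ : 0 < σ)
    {n₁ : ℕ} (hn₁ : 1 ≤ n₁) : ∃ B : Ω → ℝ, MemLp B 2 P ∧ ∀ᵐ ω ∂P, ∀ v : ℝ, 1 ≤ v →
      |stopNReal X Y n₁ v ω / nReq v σ| ≤ B ω := by
  obtain ⟨M, hM2, hM0, hM⟩ := h.exists_memLp_two_bound hn₁
  refine ⟨fun ω => ((n₁ : ℝ) + 1 + M ω) * (σ ^ 2)⁻¹,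
    ((memLp_const ((n₁ : ℝ) + 1)).add hM2).mul_const _, ?_⟩
  filter_upwards [hM] with ω hω v hv
  have hv0 : 0 < v := zero_lt_one.trans_le hv
  have h0 : 0 ≤ stopNReal X Y n₁ v ω := Nat.cast_nonneg _
  rw [nReq, abs_of_nonneg (by positivity), ← div_eq_mul_inv, ← div_div]
  gcongr
  rw [div_le_iff₀ hv0]
  refine (hω v hv0).2.trans ?_
  nlinarith [Nat.cast_nonneg (α := ℝ) n₁]

theorem tendsto_integral_stopNReal_div_nReq (h : IsTwoSampleGaussian P μ₁ μ₂ σ X Y)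
    (hσ : 0 < σ) {n₁ : ℕ} (hn₁ : 1 ≤ n₁) :
    Tendsto (fun v : ℝ => ∫ ω, stopNReal X Y n₁ v ω / nReq v σ ∂P) atTop
      (𝓝 (1 + (μ₁ - μ₂) ^ 2 / (4 * σ ^ 2))) := by
  obtain ⟨B, hB2, hB⟩ := h.exists_memLp_two_bound_div_nReq hσ hn₁
  have key := tendsto_integral_filter_of_dominated_convergence (l := (atTop : Filter ℝ)) (μ := P)
    (F := fun v ω => stopNReal X Y n₁ v ω / nReq v σ)
    (f := fun _ => 1 + (μ₁ - μ₂) ^ 2 / (4 * σ ^ 2)) B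
    (Eventually.of_forall fun v =>
      ((h.aemeasurable_stopNReal n₁ v).div_const _).aestronglyMeasurable)
    (by
      filter_upwards [eventually_ge_atTop 1] with v hv
      filter_upwards [hB] with ω hω using hω v hv)
    (hB2.integrable one_le_two) (h.ae_tendsto_stopNReal_div_nReq hσ hn₁)
  simpa using key

theorem tendsto_integral_stopNReal_sq_div_nReq_sq (h : IsTwoSampleGaussian P μ₁ μ₂ σ X Y)
    (hσ : 0 < σ) {n₁ : ℕ} (hn₁ : 1 ≤ n₁) :
    Tendsto (fun v : ℝ => ∫ ω, stopNReal X Y n₁ v ω ^ 2 / nReq v σ ^ 2 ∂P) atTop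
      (𝓝 ((1 + (μ₁ - μ₂) ^ 2 / (4 * σ ^ 2)) ^ 2)) := by
  obtain ⟨B, hB2, hB⟩ := h.exists_memLp_two_bound_div_nReq hσ hn₁
  have key := tendsto_integral_filter_of_dominated_convergence (l := (atTop : Filter ℝ)) (μ := P)
    (F := fun v ω => stopNReal X Y n₁ v ω ^ 2 / nReq v σ ^ 2)
    (f := fun _ => (1 + (μ₁ - μ₂) ^ 2 / (4 * σ ^ 2)) ^ 2) (fun ω => B ω ^ 2)
    (Eventually.of_forall fun v =>
      (((h.aemeasurable_stopNReal n₁ v).pow_const 2).div_const _).aestronglyMeasurable)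
    (by
      filter_upwards [eventually_ge_atTop 1] with v hv
      filter_upwards [hB] with ω hω
      rw [← div_pow, norm_pow, Real.norm_eq_abs]
      exact pow_le_pow_left₀ (abs_nonneg _) (hω v hv) 2)
    hB2.integrable_sq (by
      filter_upwards [h.ae_tendsto_stopNReal_div_nReq hσ hn₁] with ω hω
      simpa only [div_pow] using hω.pow 2)
  simpa using key

theorem tendsto_integral_stopNReal_atTop (h : IsTwoSampleGaussian P μ₁ μ₂ σ X Y)
    (hσ : 0 < σ) {n₁ : ℕ} (hn₁ : 1 ≤ n₁) :
    Tendsto (fun v : ℝ => ∫ ω, stopNReal X Y n₁ v ω ∂P) atTop atTop := by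
  have hreq : Tendsto (fun v : ℝ => nReq v σ) atTop atTop :=
    tendsto_id.atTop_mul_const (by positivity)
  refine ((h.tendsto_integral_stopNReal_div_nReq hσ hn₁).pos_mul_atTop (by positivity) hreq).congr'
    ?_
  filter_upwards [hreq.eventually_gt_atTop 0] with v hv
  rw [integral_div, div_mul_cancel₀ _ hv.ne']

end IsTwoSampleGaussian

/-! ### Convergence in measure along a real parameter -/

section InMeasure

variable {Ω : Type*} [MeasurableSpace Ω] {P : Measure Ω} [IsFiniteMeasure P]

theorem tendstoInMeasure_atTop_of_ae_tendsto {f : ℝ → Ω → ℝ} {g : Ω → ℝ}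
    (hf : ∀ v, AEMeasurable (f v) P)
    (h : ∀ᵐ ω ∂P, Tendsto (fun v => f v ω) atTop (𝓝 (g ω))) : TendstoInMeasure P f atTop g := by
  intro ε hε
  refine tendsto_of_seq_tendsto fun u hu => ?_
  exact tendstoInMeasure_of_tendsto_ae (f := fun n => f (u n))
    (fun n => (hf (u n)).aestronglyMeasurable) (h.mono fun ω hω => hω.comp hu) ε hε

/-- The subsequence criterion is available because `atTop` on `ℝ` is countably generated. -/
theorem tendstoInMeasure_atTop_of_subseq {f : ℝ → Ω → ℝ} {g : Ω → ℝ}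
    (hf : ∀ v, AEMeasurable (f v) P)
    (h : ∀ u : ℕ → ℝ, Tendsto u atTop atTop → ∃ φ : ℕ → ℕ,
      ∀ᵐ ω ∂P, Tendsto (fun k => f (u (φ k)) ω) atTop (𝓝 (g ω))) :
    TendstoInMeasure P f atTop g := by
  intro ε hε
  refine tendsto_of_subseq_tendsto fun u hu => ?_
  obtain ⟨φ, hφ⟩ := h u hu
  exact ⟨φ, tendstoInMeasure_of_tendsto_ae (f := fun k => f (u (φ k)))
    (fun k => (hf _).aestronglyMeasurable) hφ ε hε⟩

end InMeasure

/-- Deterministic bounds for `2 (N / v) (N - θ v)` from the two inequalities that a stopping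
index satisfies, in terms of the centred partial sums. -/
theorem stopping_squeeze {x y : ℕ → ℝ} {m θ v : ℝ} (hθ : 0 ≤ θ) (hv : 0 < v) {N : ℕ} (hN : 2 ≤ N)
    (hle : blindVar x y N ≤ (N : ℝ) / v) (hlt : ((N : ℝ) - 1) / v < blindVar x y (N - 1)) :
    (∑ i ∈ Finset.range N, ((x i - m) ^ 2 + (y i - m) ^ 2 - 2 * θ)) -
        (∑ i ∈ Finset.range N, (x i + y i - 2 * m)) ^ 2 / (2 * N) ≤
      2 * (N / v) * (N - θ * v) ∧
    2 * (N / v) * (N - θ * v) ≤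
      (∑ i ∈ Finset.range (N - 1), ((x i - m) ^ 2 + (y i - m) ^ 2 - 2 * θ)) + 5 * (N / v) := by
  have hN1 : 1 ≤ N := by omega
  have hM1 : 1 ≤ N - 1 := by omega
  have hMcast : ((N - 1 : ℕ) : ℝ) = N - 1 := by rw [Nat.cast_sub hN1, Nat.cast_one]
  have hNR : (2 : ℝ) ≤ N := by exact_mod_cast hN
  have hNv : 0 ≤ (N : ℝ) / v := by positivity
  rw [blindVar_eq_centered x y m hN1, div_le_iff₀ (two_mul_sub_one_pos hN1)] at hle
  rw [blindVar_eq_centered x y m hM1, lt_div_iff₀ (two_mul_sub_one_pos hM1), hMcast] at hlt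
  have hq : 0 ≤ (∑ i ∈ Finset.range (N - 1), (x i + y i - 2 * m)) ^ 2 / (2 * ((N : ℝ) - 1)) := by
    have : (0 : ℝ) < N - 1 := by linarith
    positivity
  have hsum : ∀ k : ℕ, ∑ i ∈ Finset.range k, ((x i - m) ^ 2 + (y i - m) ^ 2 - 2 * θ) =
      ∑ i ∈ Finset.range k, ((x i - m) ^ 2 + (y i - m) ^ 2) - k * (2 * θ) := fun k => by
    rw [Finset.sum_sub_distrib]
    simp
  rw [hsum, hsum, hMcast]
  set T := ∑ i ∈ Finset.range N, ((x i - m) ^ 2 + (y i - m) ^ 2)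
  set T' := ∑ i ∈ Finset.range (N - 1), ((x i - m) ^ 2 + (y i - m) ^ 2)
  have hkey : 2 * ((N : ℝ) / v) * (N - θ * v) = 2 * (N / v) * N - 2 * N * θ := by
    field_simp
  have hsub : ((N : ℝ) - 1) / v = N / v - 1 / v := sub_div _ _ _
  have hinv : 0 < 1 / v := by positivity
  rw [hsub] at hlt
  rw [hkey]
  have hone : (N : ℝ) / v = N * (1 / v) := by ring
  constructor
  · nlinarith
  -- The constant 5 comes from (N - 1)(2N - 3) = 2N² - 5N + 3; the leftover 2θ from centring N - 1
  -- instead of N terms has the favourable sign.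
  · rw [hone] at hlt ⊢
    nlinarith

/-! ### Reduction to a sum with a deterministic index -/

namespace IsTwoSampleGaussian

variable {Ω : Type*} [MeasurableSpace Ω] {P : Measure Ω} [IsProbabilityMeasure P]
  {μ₁ μ₂ σ : ℝ} {X Y : ℕ → Ω → ℝ}

open Finset in
/-- The quadratically corrected sample size has the same fluctuations as the centred sum of
squares at a deterministic index. -/
theorem tendstoInMeasure_stopNReal_sub_sum (h : IsTwoSampleGaussian P μ₁ μ₂ σ X Y) (hσ : 0 < σ)
    {n₁ : ℕ} (hn₁ : 1 ≤ n₁) {θ : ℝ} (hθ : θ = σ ^ 2 + (μ₁ - μ₂) ^ 2 / 4) :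
    TendstoInMeasure P (fun v ω =>
      2 * (stopNReal X Y n₁ v ω / v) * (stopNReal X Y n₁ v ω - θ * v) / √v -
        (∑ i ∈ range ⌊θ * v⌋₊, (pairSq X Y ((μ₁ + μ₂) / 2) i ω - 2 * θ)) / √v) atTop 0 := by
  set m := (μ₁ + μ₂) / 2 with hm
  have hθ0 : 0 < θ := by rw [hθ]; positivity
  have hdiv := h.ae_tendsto_stopNReal_div hσ hn₁
  rw [← hθ] at hdiv
  have hNm : ∀ v, AEMeasurable (fun ω => (stopN X Y n₁ v ω).toNat) P := fun v =>
    aemeasurable_stopN_toNat h.aemeasurable_left h.aemeasurable_right n₁ v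
  have hsqrt : Tendsto (fun v : ℝ => √v) atTop atTop := Real.tendsto_sqrt_atTop
  have hinv : Tendsto (fun v : ℝ => v⁻¹) atTop (𝓝 0) := tendsto_inv_atTop_zero
  have hfloor : Tendsto (fun v : ℝ => (⌊θ * v⌋₊ : ℝ) / v) atTop (𝓝 θ) :=
    tendsto_nat_floor_mul_div_atTop hθ0.le
  -- the three replacements of a random index
  have hWind : iIndepFun (fun i ω => pairSq X Y m i ω - 2 * θ) P :=
    (h.iIndepFun_pairSq m).comp (fun _ x => x - 2 * θ) fun _ => by fun_prop
  have hWL2 : ∀ i, MemLp (fun ω => pairSq X Y m i ω - 2 * θ) 2 P := fun i =>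
    (h.memLp_pairSq m i).sub (memLp_const _)
  have hWmean : ∀ i, P[fun ω => pairSq X Y m i ω - 2 * θ] = 0 := fun i => by
    rw [integral_sub ((h.memLp_pairSq m i).integrable one_le_two) (integrable_const _),
      h.integral_pairSq, ← hθ]
    simp
  have hWvar : ∀ i, Var[fun ω => pairSq X Y m i ω - 2 * θ; P] ≤
      4 * σ ^ 4 + 2 * σ ^ 2 * (μ₁ - μ₂) ^ 2 := fun i => by
    rw [variance_sub_const (h.memLp_pairSq m i).aestronglyMeasurable, h.variance_pairSq]
  have hA1 := tendstoInMeasure_sum_randomIndex hWind hWL2 hWmean hWvar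
    (N := fun v ω => (stopN X Y n₁ v ω).toNat) (n₀ := fun v => ⌊θ * v⌋₊) hsqrt
    (tendstoInMeasure_atTop_of_ae_tendsto
      (fun v => (((measurable_from_top (f := fun n : ℕ => (n : ℝ))).comp_aemeasurable
        (hNm v)).sub_const _).div_const _) (by
      filter_upwards [hdiv] with ω hω
      have := hω.sub hfloor
      rw [sub_self] at this
      refine this.congr' ?_
      filter_upwards [eventually_ge_atTop 0] with v hv
      rw [Real.sq_sqrt hv, sub_div, stopNReal]))
  have hA2 := tendstoInMeasure_sum_randomIndex hWind hWL2 hWmean hWvar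
    (N := fun v ω => (stopN X Y n₁ v ω).toNat - 1) (n₀ := fun v => ⌊θ * v⌋₊) hsqrt
    (tendstoInMeasure_atTop_of_ae_tendsto
      (fun v => (((measurable_from_top (f := fun n : ℕ => ((n - 1 : ℕ) : ℝ))).comp_aemeasurable
        (hNm v)).sub_const _).div_const _) (by
      filter_upwards [hdiv, h.ae_tendsto_stopNReal_atTop hσ hn₁] with ω hω hω'
      have := (hω.sub hfloor).sub hinv
      rw [sub_self, sub_zero] at this
      refine this.congr' ?_
      filter_upwards [eventually_ge_atTop 0, hω'.eventually_ge_atTop 1] with v hv hv1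
      have hv1' : 1 ≤ (stopN X Y n₁ v ω).toNat := by
        rw [stopNReal] at hv1
        exact_mod_cast hv1
      rw [Real.sq_sqrt hv, stopNReal, Nat.cast_sub hv1', Nat.cast_one]
      ring))
  -- Comparison with index 0 at scale v^(3/4) is legitimate since N/v^(3/2) → 0. It gives
  -- (ΣD_i)²/v^(3/2) → 0, which is what makes the quadratic correction (ΣD_i)²/(2N) of order o(√v).
  have hA3 := tendstoInMeasure_sum_randomIndex (h.iIndepFun_pairDev m) (h.memLp_pairDev m)
    h.integral_pairDev (fun i => ((h.identDistrib_pairDev m i).variance_eq).le)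
    (N := fun v ω => (stopN X Y n₁ v ω).toNat) (n₀ := fun _ => 0) (b := fun v => √v * √√v)
    (hsqrt.atTop_mul_atTop₀ (hsqrt.comp hsqrt))
    (tendstoInMeasure_atTop_of_ae_tendsto
      (fun v => (((measurable_from_top (f := fun n : ℕ => (n : ℝ))).comp_aemeasurable
        (hNm v)).sub_const _).div_const _) (by
      filter_upwards [hdiv] with ω hω
      have := hω.mul (tendsto_inv_atTop_zero.comp hsqrt)
      rw [mul_zero] at this
      refine this.congr' ?_
      filter_upwards [eventually_gt_atTop 0] with v hv
      rw [mul_pow, Real.sq_sqrt hv.le, Real.sq_sqrt (Real.sqrt_nonneg v), stopNReal]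
      simp only [Function.comp, Nat.cast_zero, sub_zero]
      field_simp))
  have hWm : ∀ v : ℝ, AEMeasurable
      (fun ω => ∑ i ∈ range ⌊θ * v⌋₊, (pairSq X Y m i ω - 2 * θ)) P := fun v =>
    (memLp_finsetSum _ fun i _ => hWL2 i).aemeasurable
  have hSm := fun v => h.aemeasurable_stopNReal n₁ v
  refine tendstoInMeasure_atTop_of_subseq (fun v => ?_) fun u hu => ?_
  · exact ((((hSm v).div_const v).const_mul 2).mul ((hSm v).sub_const _)).div_const _ |>.sub
      ((hWm v).div_const _)
  -- Along a common subsequence the three limits in measure hold almost surely, so the deterministic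
  -- squeeze can be used path by path.
  obtain ⟨φ₁, hφ₁, h1⟩ := TendstoInMeasure.exists_seq_tendsto_ae (fun ε hε => (hA1 ε hε).comp hu)
  obtain ⟨φ₂, hφ₂, h2⟩ := TendstoInMeasure.exists_seq_tendsto_ae
    (fun ε hε => (hA2 ε hε).comp (hu.comp hφ₁.tendsto_atTop))
  obtain ⟨φ₃, hφ₃, h3⟩ := TendstoInMeasure.exists_seq_tendsto_ae
    (fun ε hε => (hA3 ε hε).comp ((hu.comp hφ₁.tendsto_atTop).comp hφ₂.tendsto_atTop))
  refine ⟨fun k => φ₁ (φ₂ (φ₃ k)), ?_⟩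
  have hw : Tendsto (fun k => u (φ₁ (φ₂ (φ₃ k)))) atTop atTop :=
    hu.comp (hφ₁.tendsto_atTop.comp (hφ₂.tendsto_atTop.comp hφ₃.tendsto_atTop))
  set w : ℕ → ℝ := fun k => u (φ₁ (φ₂ (φ₃ k))) with hwdef
  filter_upwards [h1, h2, h3, hdiv, h.ae_tendsto_blindVar, h.ae_blindVar_pos hσ]
    with ω l1 l2 l3 ldiv lvar lpos
  have l1' := l1.comp (hφ₂.tendsto_atTop.comp hφ₃.tendsto_atTop)
  have l2' := l2.comp hφ₃.tendsto_atTop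
  have ldiv' := ldiv.comp hw
  have hlow := l1'.sub ((l3.pow 2).mul ((ldiv'.inv₀ hθ0.ne').div_const 2))
  have hupp := l2'.add ((ldiv'.const_mul 5).mul ((tendsto_inv_atTop_zero.comp hsqrt).comp hw))
  simp only [Pi.zero_apply, ne_eq, OfNat.ofNat_ne_zero, not_false_eq_true, zero_pow, zero_mul,
    sub_zero, mul_zero, add_zero] at hlow hupp
  have hev := (eventually_blindVar_le_and_lt hn₁ lpos lvar).and (eventually_gt_atTop 0)
  have hsq : ∀ᶠ k in atTop, _ := hw.eventually hev
  refine tendsto_of_tendsto_of_tendsto_of_le_of_le' hlow hupp ?_ ?_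
  · filter_upwards [hsq] with k hk
    obtain ⟨⟨hN2, hle, hlt⟩, hv⟩ := hk
    have key : (∑ i ∈ range (stopN X Y n₁ (w k) ω).toNat, (pairSq X Y m i ω - 2 * θ)) -
        (∑ i ∈ range (stopN X Y n₁ (w k) ω).toNat, pairDev X Y m i ω) ^ 2 /
          (2 * stopNReal X Y n₁ (w k) ω) ≤
        2 * (stopNReal X Y n₁ (w k) ω / w k) * (stopNReal X Y n₁ (w k) ω - θ * w k) :=
      (stopping_squeeze (m := m) hθ0.le hv hN2 hle hlt).1
    have hs0 : 0 < √(w k) := Real.sqrt_pos.2 hv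
    have hb : (√(w k) * √√(w k)) ^ 2 = w k * √(w k) := by
      rw [mul_pow, Real.sq_sqrt hv.le, Real.sq_sqrt hs0.le]
    have hNpos : 0 < stopNReal X Y n₁ (w k) ω := Nat.cast_pos.2 (two_pos.trans_le hN2)
    change (∑ i ∈ range (stopN X Y n₁ (w k) ω).toNat, (pairSq X Y m i ω - 2 * θ) -
        ∑ i ∈ range ⌊θ * w k⌋₊, (pairSq X Y m i ω - 2 * θ)) / √(w k) -
      ((∑ i ∈ range (stopN X Y n₁ (w k) ω).toNat, pairDev X Y m i ω -
        ∑ i ∈ range 0, pairDev X Y m i ω) / (√(w k) * √√(w k))) ^ 2 *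
        ((stopNReal X Y n₁ (w k) ω / w k)⁻¹ / 2) ≤
      2 * (stopNReal X Y n₁ (w k) ω / w k) * (stopNReal X Y n₁ (w k) ω - θ * w k) / √(w k) -
        (∑ i ∈ range ⌊θ * w k⌋₊, (pairSq X Y m i ω - 2 * θ)) / √(w k)
    have hQ : ∀ q : ℝ, (q / (√(w k) * √√(w k))) ^ 2 *
        ((stopNReal X Y n₁ (w k) ω / w k)⁻¹ / 2) =
        q ^ 2 / (2 * stopNReal X Y n₁ (w k) ω) / √(w k) := fun q => by
      rw [div_pow, hb]
      field_simp
    have key' := div_le_div_of_nonneg_right key hs0.le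
    rw [sub_div] at key'
    rw [range_zero, sum_empty, sub_zero, hQ, sub_div]
    linarith
  · filter_upwards [hsq] with k hk
    obtain ⟨⟨hN2, hle, hlt⟩, hv⟩ := hk
    have key : 2 * (stopNReal X Y n₁ (w k) ω / w k) * (stopNReal X Y n₁ (w k) ω - θ * w k) ≤
        (∑ i ∈ range ((stopN X Y n₁ (w k) ω).toNat - 1), (pairSq X Y m i ω - 2 * θ)) +
          5 * (stopNReal X Y n₁ (w k) ω / w k) :=
      (stopping_squeeze (m := m) hθ0.le hv hN2 hle hlt).2
    have key' := div_le_div_of_nonneg_right key (Real.sqrt_nonneg (w k))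
    rw [add_div, div_eq_mul_inv (5 * _)] at key'
    change 2 * (stopNReal X Y n₁ (w k) ω / w k) * (stopNReal X Y n₁ (w k) ω - θ * w k) / √(w k) -
        (∑ i ∈ range ⌊θ * w k⌋₊, (pairSq X Y m i ω - 2 * θ)) / √(w k) ≤
      (∑ i ∈ range ((stopN X Y n₁ (w k) ω).toNat - 1), (pairSq X Y m i ω - 2 * θ) -
        ∑ i ∈ range ⌊θ * w k⌋₊, (pairSq X Y m i ω - 2 * θ)) / √(w k) +
        5 * (stopNReal X Y n₁ (w k) ω / w k) * (√(w k))⁻¹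
    rw [sub_div]
    linarith

end IsTwoSampleGaussian

/-! ### Asymptotic normality -/

namespace IsTwoSampleGaussian

variable {Ω : Type*} [MeasurableSpace Ω] {P : Measure Ω} [IsProbabilityMeasure P]
  {μ₁ μ₂ σ : ℝ} {X Y : ℕ → Ω → ℝ}

theorem tendstoInDistribution_stopNReal (h : IsTwoSampleGaussian P μ₁ μ₂ σ X Y) (hσ : 0 < σ)
    {n₁ : ℕ} (hn₁ : 1 ≤ n₁) :
    TendstoInDistribution
      (fun (v : ℝ) ω =>
        (stopNReal X Y n₁ v ω - nReq v σ * (1 + (μ₁ - μ₂) ^ 2 / (4 * σ ^ 2))) / √(nReq v σ))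
      atTop (id : ℝ → ℝ) (fun _ => P)
      (gaussianReal 0
        ((4 * σ ^ 2 + 2 * (μ₁ - μ₂) ^ 2) / (4 * σ ^ 2 + (μ₁ - μ₂) ^ 2)).toNNReal) := by
  set m := (μ₁ + μ₂) / 2 with hm
  obtain ⟨θ, hθ⟩ : ∃ θ, θ = σ ^ 2 + (μ₁ - μ₂) ^ 2 / 4 := ⟨_, rfl⟩
  have hθ0 : 0 < θ := by rw [hθ]; positivity
  set s := (4 * σ ^ 2 + 2 * (μ₁ - μ₂) ^ 2) / (4 * σ ^ 2 + (μ₁ - μ₂) ^ 2) with hs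
  have hs0 : 0 ≤ s := by positivity
  have hSm := fun v => h.aemeasurable_stopNReal n₁ v
  have hdiv := h.ae_tendsto_stopNReal_div hσ hn₁
  rw [← hθ] at hdiv
  -- Total rescaling after the central limit theorem: √θ is the limit of √⌊θv⌋/√v and 1/(2θσ) that
  -- of v/(2Nσ). Hence s = κ² Var W.
  set κ : ℝ := √θ * (1 / (2 * θ * σ)) with hκ
  have hκ0 : κ ≠ 0 := by positivity
  -- the limit variable, rescaled to the variance of a single summand
  have hlaw : HasLaw (fun z : ℝ => κ⁻¹ * z)
      (gaussianReal 0 Var[pairSq X Y m 0; P].toNNReal) (gaussianReal 0 s.toNNReal) := by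
    have h1 := gaussianReal_const_mul (HasLaw.id (μ := gaussianReal 0 s.toNNReal)) κ⁻¹
    rw [mul_zero] at h1
    convert! h1 using 2
    rw [h.variance_pairSq]
    ext
    have hτ : 0 ≤ 4 * σ ^ 4 + 2 * σ ^ 2 * (μ₁ - μ₂) ^ 2 := by positivity
    simp only [NNReal.coe_mul, Real.coe_toNNReal _ hτ, Real.coe_toNNReal _ hs0, NNReal.coe_mk]
    have hκ2 : κ⁻¹ ^ 2 = 4 * θ * σ ^ 2 := by
      rw [hκ, inv_pow, mul_pow, Real.sq_sqrt hθ0.le]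
      field_simp
      norm_num
    rw [hκ2, hs, hθ]
    field_simp
  have hclt := tendstoInDistribution_inv_sqrt_mul_sum_sub hlaw (h.memLp_pairSq m 0)
    (h.iIndepFun_pairSq m) (h.identDistrib_pairSq m)
  rw [h.integral_pairSq, ← hθ] at hclt
  have hfloor : Tendsto (fun v : ℝ => ⌊θ * v⌋₊) atTop atTop :=
    tendsto_nat_floor_atTop.comp (tendsto_id.const_mul_atTop hθ0)
  have hclt' : TendstoInDistribution (fun (v : ℝ) ω => (√(⌊θ * v⌋₊ : ℝ))⁻¹ *
      (∑ k ∈ Finset.range ⌊θ * v⌋₊, pairSq X Y m k ω - (⌊θ * v⌋₊ : ℝ) * (2 * θ))) atTop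
      (fun z : ℝ => κ⁻¹ * z) (fun _ => P) (gaussianReal 0 s.toNNReal) :=
    ⟨fun v => hclt.forall_aemeasurable _, hclt.aemeasurable_limit, hclt.tendsto.comp hfloor⟩
  have hratio : Tendsto (fun v : ℝ => √(⌊θ * v⌋₊ : ℝ) / √v) atTop (𝓝 √θ) := by
    have h1 := (tendsto_nat_floor_mul_div_atTop (R := ℝ) hθ0.le).sqrt
    refine h1.congr fun v => ?_
    rw [Real.sqrt_div (Nat.cast_nonneg _)]
  have hsum := hclt'.continuous_comp_prodMk_of_tendstoInMeasure_const (c := √θ)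
    (g := fun z : ℝ × ℝ => z.1 * z.2) continuous_mul
    (Y := fun (v : ℝ) _ => √(⌊θ * v⌋₊ : ℝ) / √v)
    (tendstoInMeasure_atTop_of_ae_tendsto (fun v => aemeasurable_const)
      (Eventually.of_forall fun _ => hratio)) (fun v => aemeasurable_const)
  have hsum' : TendstoInDistribution (fun (v : ℝ) ω =>
      (∑ i ∈ Finset.range ⌊θ * v⌋₊, (pairSq X Y m i ω - 2 * θ)) / √v) atTop
      (fun z : ℝ => κ⁻¹ * z * √θ) (fun _ => P) (gaussianReal 0 s.toNNReal) := by
    convert! hsum using 3 with v ω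
    rw [Finset.sum_sub_distrib, Finset.sum_const, Finset.card_range, nsmul_eq_mul]
    rcases Nat.eq_zero_or_pos ⌊θ * v⌋₊ with h0 | h0
    · simp [h0]
    · have : 0 < √(⌊θ * v⌋₊ : ℝ) := Real.sqrt_pos.2 (Nat.cast_pos.2 h0)
      field_simp
  have hquad := tendstoInDistribution_of_tendstoInMeasure_sub
    (fun v ω => 2 * (stopNReal X Y n₁ v ω / v) * (stopNReal X Y n₁ v ω - θ * v) / √v) _ hsum'
    (h.tendstoInMeasure_stopNReal_sub_sum hσ hn₁ hθ)
    (fun v => (((hSm v).div_const v).const_mul 2 |>.mul ((hSm v).sub_const _)).div_const _)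
  -- Multiplying 2(N/v)(N - θv)/√v by v/(2Nσ) gives exactly (N - θv)/(σ√v).
  have hRm : ∀ v : ℝ, AEMeasurable (fun ω => v / (2 * stopNReal X Y n₁ v ω * σ)) P := fun v =>
    (((hSm v).const_mul 2).mul_const σ).const_div v
  have hR : ∀ᵐ ω ∂P, Tendsto (fun v : ℝ => v / (2 * stopNReal X Y n₁ v ω * σ)) atTop
      (𝓝 (1 / (2 * θ * σ))) := by
    filter_upwards [hdiv] with ω hω
    refine (((hω.const_mul 2).mul_const σ).inv₀ (by positivity) |>.congr fun v => ?_).trans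
      (by rw [one_div])
    rw [show 2 * (stopNReal X Y n₁ v ω / v) * σ = 2 * stopNReal X Y n₁ v ω * σ / v by ring,
      inv_div]
  have hprod := hquad.continuous_comp_prodMk_of_tendstoInMeasure_const (c := 1 / (2 * θ * σ))
    (g := fun z : ℝ × ℝ => z.1 * z.2) continuous_mul
    (tendstoInMeasure_atTop_of_ae_tendsto hRm hR) hRm
  have hlim : (fun z : ℝ => κ⁻¹ * z * √θ * (1 / (2 * θ * σ))) = id := by
    ext z
    rw [id, mul_assoc, ← hκ]
    field_simp
  simp only [hlim] at hprod
  refine tendstoInDistribution_of_tendstoInMeasure_sub _ _ hprod ?_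
    fun v => ((hSm v).sub_const _).div_const _
  refine tendstoInMeasure_atTop_of_ae_tendsto (fun v => ?_) ?_
  · exact (((hSm v).sub_const _).div_const _).sub (hprod.forall_aemeasurable v)
  -- On almost every path the difference vanishes identically once v and N are positive, so that the
  -- factor N cancels.
  filter_upwards [h.ae_tendsto_stopNReal_atTop hσ hn₁] with ω hω
  refine tendsto_const_nhds.congr' ?_
  filter_upwards [hω.eventually_gt_atTop 0, eventually_gt_atTop 0] with v hN hv
  have hsv : 0 < √v := Real.sqrt_pos.2 hv
  have hreq : nReq v σ * (1 + (μ₁ - μ₂) ^ 2 / (4 * σ ^ 2)) = θ * v := by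
    rw [nReq, hθ]
    field_simp
  have hroot : √(nReq v σ) = √v * σ := by
    rw [nReq, Real.sqrt_mul hv.le, Real.sqrt_sq hσ.le]
  simp only [Pi.zero_apply, Pi.sub_apply, hreq, hroot]
  field_simp
  ring

end IsTwoSampleGaussian

theorem theorem4 {Ω : Type*} [MeasurableSpace Ω] (P : Measure Ω) [IsProbabilityMeasure P]
    (μ₁ μ₂ σ : ℝ) (hσ : 0 < σ) (n₁ : ℕ) (hn₁ : 1 ≤ n₁)
    (X Y : ℕ → Ω → ℝ)
    (hX : ∀ i, HasLaw (X i) (gaussianReal μ₁ (σ ^ 2).toNNReal) P)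
    (hY : ∀ j, HasLaw (Y j) (gaussianReal μ₂ (σ ^ 2).toNNReal) P)
    (hindep : iIndepFun (Sum.elim X Y) P) :
    -- (i) almost surely finite for all `v` at once, with finite first and second moments
    (∀ᵐ ω ∂P, ∀ v : ℝ, 0 < v → stopN X Y n₁ v ω < ⊤) ∧
    (∀ v : ℝ, 0 < v → Integrable (stopNReal X Y n₁ v) P) ∧
    (∀ v : ℝ, 0 < v → Integrable (fun ω => stopNReal X Y n₁ v ω ^ 2) P) ∧
    -- (i) non-decreasing in `v`
    (∀ ω, MonotoneOn (fun v : ℝ => stopN X Y n₁ v ω) (Set.Ioi 0)) ∧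
    -- (i) divergence, almost surely and in expectation
    (∀ᵐ ω ∂P, Tendsto (fun v : ℝ => stopNReal X Y n₁ v ω) atTop atTop) ∧
    Tendsto (fun v : ℝ => ∫ ω, stopNReal X Y n₁ v ω ∂P) atTop atTop ∧
    -- (ii)
    (∀ᵐ ω ∂P, Tendsto (fun v : ℝ => stopNReal X Y n₁ v ω / nReq v σ) atTop
      (𝓝 (1 + (μ₁ - μ₂) ^ 2 / (4 * σ ^ 2)))) ∧
    -- (iii)
    Tendsto (fun v : ℝ => ∫ ω, stopNReal X Y n₁ v ω / nReq v σ ∂P) atTop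
      (𝓝 (1 + (μ₁ - μ₂) ^ 2 / (4 * σ ^ 2))) ∧
    -- (iv)
    Tendsto (fun v : ℝ => ∫ ω, stopNReal X Y n₁ v ω ^ 2 / nReq v σ ^ 2 ∂P) atTop
      (𝓝 ((1 + (μ₁ - μ₂) ^ 2 / (4 * σ ^ 2)) ^ 2)) ∧
    -- (v)
    TendstoInDistribution
      (fun (v : ℝ) ω =>
        (stopNReal X Y n₁ v ω - nReq v σ * (1 + (μ₁ - μ₂) ^ 2 / (4 * σ ^ 2))) / √(nReq v σ))
      atTop (id : ℝ → ℝ) (fun _ => P)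
      (gaussianReal 0
        ((4 * σ ^ 2 + 2 * (μ₁ - μ₂) ^ 2) / (4 * σ ^ 2 + (μ₁ - μ₂) ^ 2)).toNNReal) := by
  have h : IsTwoSampleGaussian P μ₁ μ₂ σ X Y := ⟨hX, hY, hindep⟩
  refine ⟨?_, fun v hv => (h.memLp_two_stopNReal hn₁ hv).integrable one_le_two,
    fun v hv => (h.memLp_two_stopNReal hn₁ hv).integrable_sq,
    fun ω v hv w _ hvw => blindSampleSize_mono hv hvw,
    h.ae_tendsto_stopNReal_atTop hσ hn₁, h.tendsto_integral_stopNReal_atTop hσ hn₁,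
    h.ae_tendsto_stopNReal_div_nReq hσ hn₁, h.tendsto_integral_stopNReal_div_nReq hσ hn₁,
    h.tendsto_integral_stopNReal_sq_div_nReq_sq hσ hn₁,
    h.tendstoInDistribution_stopNReal hσ hn₁⟩
  obtain ⟨M, -, -, hM⟩ := h.exists_memLp_two_bound hn₁
  filter_upwards [hM] with ω hω v hv using (hω v hv).1
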